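/- Let $d\ge 2$, $\mathbb{H}=\{i\in\mathbb{Z}^d: i_d\ge 1\}$, $\mathcal{W}=\{i\in\mathbb{H}: i_d=1\}$, and write $i\sim j$ if $\|i-j\|_1=1$. For $J>0$, $\lambda\in\mathbb{R}$, a field $h=(h_i)_{i\in\mathbb{H}}$, a finite $\Lambda\subset\mathbb{H}$ and the boundary conditions $\eta\equiv+1$ and $\eta\equiv-1$ (denoted $\pm$), the semi-infinite Ising model in $\Lambda$ is the Gibbs measure with weights $e^{-\mathcal{H}_\Lambda(\sigma)}$ and partition function $\mathcal{Z}^{\pm}_{\Lambda;\lambda,h}$ on the configurations $\sigma\in\{-1,1\}^{\mathbb{H}}$ that equal $\eta$ outside $\Lambda$, where $$\mathcal{H}_\Lambda(\sigma)=-\sum_{\substack{\{i,j\}\subset\mathbb{H},\ i\sim j\\ \{i,j\}\cap\Lambda\ne\emptyset}}J\sigma_i\sigma_j-\sum_{i\in\Lambda}h_i\sigma_i-\sum_{i\in\Lambda\cap\mathcal{W}}\lambda\sigma_i .$$ Its infinite-volume states $\langle\cdot\rangle^{\pm}_{J,\lambda,h}$ are the weak limits of the finite-volume measures with boundary condition $\pm$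 as $\Lambda\nearrow\mathbb{H}$. Let $\Lambda_n=[-n,n]^{d-1}\times[1,n]$, $\mathcal{W}_n=[-n,n]^{d-1}\times\{1\}$, and let $\Delta_n$ be the union of $\Lambda_n$ and its reflection in the hyperplane $i_d=\tfrac12$ (all intersected with $\mathbb{Z}^d$). Let $Q^{\pm}_{\Delta_n}$ be the partition function of the nearest-neighbour Ising model on $\mathbb{Z}^d$ in $\Delta_n$ with interaction $J$, no external field and boundary condition $\pm$. Put $$F^{\pm}(J,\lambda,h)=\lim_{n\to\infty}-\frac{1}{2|\mathcal{W}_n|}\ln\frac{(\mathcal{Z}^{\pm}_{\Lambda_n;\lambda,h})^2}{Q^{\pm}_{\Delta_n}},\qquad \tau_w(J,\lambda,h)=F^-(J,\lambda,h)-F^+(J,\lambda,h),$$ and omit the wall influence from the notation when it is $0$: $\tau_w(J,h)=\tau_w(J,0,h)$ and $\langle\cdot\rangle^\pm_{J,h}=\langle\cdot\rangle^\pm_{J,0,h}$. **Proposition.** Let $d\ge2$, $J>0$, $\delta>1$ and $\lambda\ge0$, and for $s\ge0$ let $\widehat{s}$ be the external field $\widehat{s}_i=s/i_d^{\delta}$,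 $i\in\mathbb{H}$. Then the states $\langle\cdot\rangle^{\pm}_{J,\widehat{s}}$, $0\le s\le\lambda$, and the limits $F^{\pm}(J,0,\widehat{\lambda})$ exist; the series below converges for every $0\le s\le\lambda$, its sum is an integrable function of $s\in[0,\lambda]$, and $$\tau_w(J,\widehat{\lambda})=\int_0^\lambda\sum_{\ell=1}^\infty\frac{1}{\ell^{\delta}}\left(\langle\sigma_{\ell e_d}\rangle^{+}_{J,\widehat{s}}-\langle\sigma_{\ell e_d}\rangle^{-}_{J,\widehat{s}}\right)ds ,$$ where $e_d=(0,\dots,0,1)$. -/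

import Mathlib

open MeasureTheory Filter Topology

noncomputable section

namespace SemiInfiniteIsing

/-! ### Ising models on a locally finite graph -/

/-- Spin configurations on the vertex set `V`; `true` encodes the spin `+1` and `false` the
spin `-1`.  The topology is the product topology and the sigma-algebra the product one. -/
abbrev Config (V : Type*) := V → Bool

/-- The numerical value `σ_i ∈ {-1, 1}` of the spin at `i`. -/
def spin {V : Type*} (σ : Config V) (i : V) : ℝ := if σ i then 1 else -1

/-- The product `σ_i σ_j` of the two spins at the ends of the unordered pair `{i, j}`. -/
def bondSpin {V : Type*} (σ : Config V) (e : Sym2 V) : ℝ :=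
  Sym2.lift ⟨fun i j => spin σ i * spin σ j, fun _ _ => mul_comm _ _⟩ e

/-- The constant boundary condition: `+` for `b = true` and `-` for `b = false`. -/
def constBC (V : Type*) (b : Bool) : Config V := fun _ => b

/-- The configuration equal to `τ` in `Λ` and to `η` outside `Λ`.  As `τ` varies, these are
exactly the configurations in `Λ` with boundary condition `η`, each obtained once. -/
def glue {V : Type*} [DecidableEq V] (Λ : Finset V) (η : Config V) (τ : Λ → Bool) : Config V :=
  fun i => if hi : i ∈ Λ then τ ⟨i, hi⟩ else η i

section Graph

variable {V : Type*} [DecidableEq V] (G : SimpleGraph V) [G.LocallyFinite]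

/-- The set of bonds `{i, j}`, `i ∼ j`, with `{i, j} ∩ Λ ≠ ∅`. -/
def bondsMeeting (Λ : Finset V) : Finset (Sym2 V) := Λ.biUnion fun i => G.incidenceFinset i

theorem mem_bondsMeeting (Λ : Finset V) (e : Sym2 V) :
    e ∈ bondsMeeting G Λ ↔ e ∈ G.edgeSet ∧ ∃ i ∈ Λ, i ∈ e := by
  simp only [bondsMeeting, Finset.mem_biUnion, SimpleGraph.mem_incidenceFinset,
    SimpleGraph.incidenceSet, Set.mem_sep_iff]
  tauto

/-- The Hamiltonian in `Λ` with uniform interaction `J` and external field `h`: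
`-∑_{i ∼ j, {i, j} ∩ Λ ≠ ∅} J σ_i σ_j - ∑_{i ∈ Λ} h_i σ_i`. -/
def hamiltonian (J : ℝ) (h : V → ℝ) (Λ : Finset V) (σ : Config V) : ℝ :=
  -(∑ e ∈ bondsMeeting G Λ, J * bondSpin σ e) - ∑ i ∈ Λ, h i * spin σ i

/-- The partition function in `Λ` with boundary condition `η`. -/
def partitionFunction (J : ℝ) (h : V → ℝ) (Λ : Finset V) (η : Config V) : ℝ :=
  ∑ τ : Λ → Bool, Real.exp (-hamiltonian G J h Λ (glue Λ η τ))

theorem partitionFunction_pos (J : ℝ) (h : V → ℝ) (Λ : Finset V) (η : Config V) :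
    0 < partitionFunction G J h Λ η :=
  Finset.sum_pos (fun _ _ => Real.exp_pos _) Finset.univ_nonempty

/-- The finite-volume Gibbs measure in `Λ` with boundary condition `η`, as a measure. -/
def gibbsMeasure (J : ℝ) (h : V → ℝ) (Λ : Finset V) (η : Config V) : Measure (Config V) :=
  ∑ τ : Λ → Bool,
    ENNReal.ofReal
        (Real.exp (-hamiltonian G J h Λ (glue Λ η τ)) / partitionFunction G J h Λ η) •
      Measure.dirac (glue Λ η τ)

instance isProbabilityMeasure_gibbsMeasure (J : ℝ) (h : V → ℝ) (Λ : Finset V) (η : Config V) :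
    IsProbabilityMeasure (gibbsMeasure G J h Λ η) := by
  constructor
  have hZ := partitionFunction_pos G J h Λ η
  simp only [gibbsMeasure, Measure.coe_finsetSum, Measure.coe_smul, Finset.sum_apply,
    Pi.smul_apply, measure_univ, smul_eq_mul, mul_one]
  rw [← ENNReal.ofReal_sum_of_nonneg fun _ _ => div_nonneg (Real.exp_pos _).le hZ.le,
    ← Finset.sum_div]
  change ENNReal.ofReal (partitionFunction G J h Λ η / _) = 1
  rw [div_self hZ.ne', ENNReal.ofReal_one]

/-- The finite-volume Gibbs measure, as a point of the space of Borel probability measures on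
the configuration space with its weak topology. -/
def gibbs (J : ℝ) (h : V → ℝ) (η : Config V) (Λ : Finset V) : ProbabilityMeasure (Config V) :=
  ⟨gibbsMeasure G J h Λ η, inferInstance⟩

/-- The infinite-volume state obtained as the weak limit of the finite-volume Gibbs measures
with boundary condition `η` as the finite set `Λ` exhausts `V` (a convention if there is no
such limit). -/
def infiniteState [Countable V] (J : ℝ) (h : V → ℝ) (η : Config V) :
    ProbabilityMeasure (Config V) :=
  limUnder atTop (gibbs G J h η)

end Graph

/-- The magnetization `⟨σ_i⟩` in the state `μ`. -/
def magnetization {V : Type*} (μ : ProbabilityMeasure (Config V)) (i : V) : ℝ :=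
  ∫ σ, spin σ i ∂(μ : Measure (Config V))

/-! ### The lattice and the half-space -/

/-- The lattice `ℤ^d = ℤ^{d-1} × ℤ` (for `d ≥ 1`); `i.2` is the last coordinate `i_d`. -/
abbrev Site (d : ℕ) := (Fin (d - 1) → ℤ) × ℤ

/-- The half-space, the set of `i ∈ ℤ^d` with `i_d ≥ 1`. -/
abbrev HalfSpace (d : ℕ) := {i : Site d // 1 ≤ i.2}

/-- The nearest-neighbour graph of `ℤ^d`: `i ∼ j` if and only if the `ℓ¹`-distance is `1`. -/
def latticeGraph (d : ℕ) : SimpleGraph (Site d) where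
  Adj i j := ∑ k, |i.1 k - j.1 k| + |i.2 - j.2| = 1
  symm := ⟨fun i j hij => by simpa only [abs_sub_comm] using hij⟩
  loopless := ⟨fun i hi => by simp at hi⟩

/-- The nearest-neighbour graph of the half-space. -/
def halfSpaceGraph (d : ℕ) : SimpleGraph (HalfSpace d) := (latticeGraph d).comap Subtype.val

theorem latticeGraph_neighborSet_finite (d : ℕ) (i : Site d) :
    ((latticeGraph d).neighborSet i).Finite := by
  refine ((Set.finite_Icc (fun k => i.1 k - 1) (fun k => i.1 k + 1)).prod
    (Set.finite_Icc (i.2 - 1) (i.2 + 1))).subset fun j hj => ?_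
  have hj' : ∑ k, |i.1 k - j.1 k| + |i.2 - j.2| = 1 := hj
  have h2 : |i.2 - j.2| ≤ 1 := by
    have := Finset.sum_nonneg fun k (_ : k ∈ Finset.univ) => abs_nonneg (i.1 k - j.1 k)
    linarith
  have h1 : ∀ k, |i.1 k - j.1 k| ≤ 1 := fun k => by
    have := Finset.single_le_sum (fun k _ => abs_nonneg (i.1 k - j.1 k)) (Finset.mem_univ k)
    have := abs_nonneg (i.2 - j.2)
    linarith
  rw [abs_le] at h2
  refine ⟨⟨fun k => ?_, fun k => ?_⟩, ⟨?_, ?_⟩⟩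
  · have := abs_le.1 (h1 k)
    simp only
    linarith
  · have := abs_le.1 (h1 k)
    simp only
    linarith
  · linarith
  · linarith

instance latticeGraph_locallyFinite (d : ℕ) : (latticeGraph d).LocallyFinite :=
  fun i => (latticeGraph_neighborSet_finite d i).fintype

instance halfSpaceGraph_locallyFinite (d : ℕ) : (halfSpaceGraph d).LocallyFinite :=
  fun i => ((latticeGraph_neighborSet_finite d i.1).preimage
    Subtype.val_injective.injOn).fintype

/-- The point `ℓ e_d` of the half-space, `ℓ ≥ 1`. -/
def axisPoint (d : ℕ) (ℓ : ℕ+) : HalfSpace d :=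
  ⟨(0, ((ℓ : ℕ) : ℤ)), Int.ofNat_le.2 ℓ.2⟩

/-- The cube `[-n, n]^{d-1}`. -/
def baseCube (d n : ℕ) : Finset (Fin (d - 1) → ℤ) := Finset.Icc (fun _ => -(n : ℤ)) fun _ => (n : ℤ)

/-- The box `Λ_n = [-n, n]^{d-1} × [1, n]`, as a set of points of `ℤ^d`. -/
def box (d n : ℕ) : Finset (Site d) := baseCube d n ×ˢ Finset.Icc 1 (n : ℤ)

/-- The box `Λ_n`, as a set of points of the half-space. -/
def halfBox (d n : ℕ) : Finset (HalfSpace d) := (box d n).subtype fun i => 1 ≤ i.2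

/-- The part `𝒲_n = [-n, n]^{d-1} × {1}` of the wall. -/
def wallBox (d n : ℕ) : Finset (Site d) := baseCube d n ×ˢ {1}

/-- The reflection of `ℤ^d` in the hyperplane `i_d = 1 / 2`. -/
def reflect {d : ℕ} (i : Site d) : Site d := (i.1, 1 - i.2)

/-- The extended box `Δ_n`, the union of `Λ_n` and its reflection. -/
def extendedBox (d n : ℕ) : Finset (Site d) := box d n ∪ (box d n).image reflect

/-! ### The semi-infinite model and its wall free energy -/

/-- The external field `h` together with the wall influence `lam`, which acts on the sites with
`i_d = 1`: the term `∑_{i ∈ Λ} h_i σ_i + ∑_{i ∈ Λ ∩ 𝒲} lam σ_i` of the Hamiltonian is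
`∑_{i ∈ Λ} (totalField lam h)_i σ_i`. -/
def totalField {d : ℕ} (lam : ℝ) (h : HalfSpace d → ℝ) : HalfSpace d → ℝ :=
  fun i => h i + if i.1.2 = 1 then lam else 0

/-- The decaying external field `i ↦ lam / i_d ^ δ`. -/
def decayingField (d : ℕ) (δ lam : ℝ) : HalfSpace d → ℝ := fun i => lam / (i.1.2 : ℝ) ^ δ

/-- The finite-volume Gibbs measure of the semi-infinite model in `Λ` with interaction `J`, wall
influence `lam`, external field `h` and boundary condition `+` (`b = true`) or `-`
(`b = false`). -/
def semiInfiniteGibbs (d : ℕ) (J lam : ℝ) (h : HalfSpace d → ℝ) (b : Bool)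
    (Λ : Finset (HalfSpace d)) : ProbabilityMeasure (Config (HalfSpace d)) :=
  gibbs (halfSpaceGraph d) J (totalField lam h) (constBC _ b) Λ

/-- The infinite-volume `+` state (`b = true`) or `-` state (`b = false`) of the semi-infinite
model. -/
def semiInfiniteState (d : ℕ) (J lam : ℝ) (h : HalfSpace d → ℝ) (b : Bool) :
    ProbabilityMeasure (Config (HalfSpace d)) :=
  infiniteState (halfSpaceGraph d) J (totalField lam h) (constBC _ b)

/-- The quantity `-(1 / (2 |𝒲_n|)) log (Z ^ 2 / Q)`, where `Z` is the partition function of the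
semi-infinite model in `Λ_n` and `Q` that of the Ising model on `ℤ^d` in `Δ_n` without external
field, both with boundary condition `+` (`b = true`) or `-` (`b = false`). -/
def surfaceFreeEnergySeq (d : ℕ) (J lam : ℝ) (h : HalfSpace d → ℝ) (b : Bool) (n : ℕ) : ℝ :=
  -(1 / (2 * ((wallBox d n).card : ℝ))) *
    Real.log
      (partitionFunction (halfSpaceGraph d) J (totalField lam h) (halfBox d n) (constBC _ b) ^ 2 /
        partitionFunction (latticeGraph d) J 0 (extendedBox d n) (constBC _ b))

/-- The surface free energy `F⁺` (`b = true`) or `F⁻` (`b = false`), the limit of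
`surfaceFreeEnergySeq` (a convention if there is no limit). -/
def surfaceFreeEnergy (d : ℕ) (J lam : ℝ) (h : HalfSpace d → ℝ) (b : Bool) : ℝ :=
  limUnder atTop (surfaceFreeEnergySeq d J lam h b)

/-- The wall free energy `τ_w = F⁻ - F⁺`. -/
def wallFreeEnergy (d : ℕ) (J lam : ℝ) (h : HalfSpace d → ℝ) : ℝ :=
  surfaceFreeEnergy d J lam h false - surfaceFreeEnergy d J lam h true

/-- The series `∑_{ℓ ≥ 1} ℓ^{-δ} (⟨σ_{ℓ e_d}⟩⁺ - ⟨σ_{ℓ e_d}⟩⁻)` has this general term, the states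
being those with external field `i ↦ s / i_d ^ δ` and no further wall influence. -/
def magnetizationGapTerm (d : ℕ) (J δ s : ℝ) (ℓ : ℕ+) : ℝ :=
  1 / ((ℓ : ℕ) : ℝ) ^ δ *
    (magnetization (semiInfiniteState d J 0 (decayingField d δ s) true) (axisPoint d ℓ) -
      magnetization (semiInfiniteState d J 0 (decayingField d δ s) false) (axisPoint d ℓ))

end SemiInfiniteIsing

end

/-! The global spin flip preserves bond energies and reverses fields, so the `-` model in field `h`
is the `+` model in field `-h`. It therefore suffices to study `+` boundary conditions with fields
of either sign.

By FKG, the `+` expectation of a nonnegative increasing function decreases as the volume grows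
(`plusMean_antitone`). Hence the probabilities of the events "all spins in `A` are `+`" converge.
They determine a measure on a compact space, so the states exist. Monotonicity combined with
invariance under translations along the wall also gives convergence of averages over translates
(`tendsto_average_plusInd`), because sites near the lateral boundary are a negligible fraction.

For the free energies, let `Z₀` be the zero-field partition function and split `log (Z² / Q)` into
`2 log (Z / Z₀)` and `log (Z₀² / Q)`. In the field of strength `s`, the `s`-derivative of `log Z`
per wall site is a sum of layer averages with weights `ℓ^{-δ}`. Since `δ > 1`, dominated convergence
gives the limit `∫₀^r P(s) ds` with `P = plusSeries` and `r = ±lam`. For `log (Q / Z₀²)`, the bonds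
crossing the reflection hyperplane are switched on from coupling `0`, where the model is two
independent half-space models, to `J`; the derivative is again a convergent average. Without field
this part is the same for both signs, so it cancels in `F⁻ - F⁺ = ∫₀^lam (P(s) + P(-s)) ds`. By the
flip, `P(-s)` is minus the series of the `-` state. -/

noncomputable section

namespace SemiInfiniteIsing

/-! ### Expectations with `+` boundary condition: FKG and monotonicity in the volume -/

section General

variable {V : Type*}

theorem spin_of_true {σ : Config V} {i : V} (h : σ i = true) : spin σ i = 1 := by simp [spin, h]

theorem abs_spin (σ : Config V) (i : V) : |spin σ i| = 1 := by
  unfold spin; split_ifs <;> simp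

theorem spin_inf_add_spin_sup (σ τ : Config V) (i : V) :
    spin (σ ⊓ τ) i + spin (σ ⊔ τ) i = spin σ i + spin τ i := by
  rcases (σ i).eq_false_or_eq_true with hσ | hσ <;>
    rcases (τ i).eq_false_or_eq_true with hτ | hτ <;> simp [spin, hσ, hτ]

/-- Supermodularity of a ferromagnetic bond, checked over the sixteen values of the four spins; it
is the source of the FKG lattice condition. -/
theorem bondSpin_add_le (σ τ : Config V) (e : Sym2 V) :
    bondSpin σ e + bondSpin τ e ≤ bondSpin (σ ⊓ τ) e + bondSpin (σ ⊔ τ) e := by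
  induction e with | _ i j
  rcases (σ i).eq_false_or_eq_true with hσ | hσ <;>
    rcases (τ i).eq_false_or_eq_true with hτ | hτ <;>
    rcases (σ j).eq_false_or_eq_true with hσ' | hσ' <;>
    rcases (τ j).eq_false_or_eq_true with hτ' | hτ' <;>
    simp [bondSpin, spin, hσ, hτ, hσ', hτ'] <;> norm_num

/-- The indicator function of the event that all spins in `A` are `+`. -/
def plusInd (A : Finset V) (σ : Config V) : ℝ := if ∀ i ∈ A, σ i = true then 1 else 0

theorem plusInd_nonneg (A : Finset V) : 0 ≤ plusInd A := fun σ => by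
  simp only [plusInd]; split_ifs <;> simp

theorem plusInd_le_one (A : Finset V) (σ : Config V) : plusInd A σ ≤ 1 := by
  simp only [plusInd]; split_ifs <;> simp

theorem plusInd_mono (A : Finset V) : Monotone (plusInd A) := by
  intro σ τ hστ
  simp only [plusInd]
  split_ifs with h1 h2 h2
  · rfl
  · exact absurd (fun i hi => top_le_iff.1 ((h1 i hi).symm.le.trans (hστ i))) h2
  · simp
  · rfl

/-- Limits are established for the increasing functions `plusInd A` only; spins reach them through
this linear expansion. -/
theorem spin_eq_plusInd (i : V) : (fun σ : Config V => spin σ i) =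
    (2 : ℝ) • plusInd {i} + (-1 : ℝ) • 1 := by
  ext σ
  simp only [spin, plusInd, Pi.add_apply, Pi.smul_apply, Finset.mem_singleton, forall_eq]
  split_ifs <;> norm_num

theorem bondSpin_map {W : Type*} (φ : V → W) (σ : Config W) (e : Sym2 V) :
    bondSpin σ (e.map φ) = bondSpin (σ ∘ φ) e := by
  induction e with | _ a b
  rfl

theorem plusInd_comp_symm (φ : V ≃ V) (A : Finset V) :
    (fun σ : Config V => plusInd (A.map φ.toEmbedding) (σ ∘ φ.symm)) = plusInd A := by
  ext σ
  refine if_congr ⟨fun H i hi => ?_, fun H i hi => ?_⟩ rfl rfl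
  · simpa using H (φ i) ((Finset.mem_map' _).2 hi)
  · obtain ⟨j, hj, rfl⟩ := Finset.mem_map.1 hi
    simpa using H j hj

variable [DecidableEq V]

theorem glue_of_mem {Λ : Finset V} {i : V} (hi : i ∈ Λ) (η : Config V) (τ : Λ → Bool) :
    glue Λ η τ i = τ ⟨i, hi⟩ := by simp [glue, hi]

theorem glue_of_notMem {Λ : Finset V} {i : V} (hi : i ∉ Λ) (η : Config V) (τ : Λ → Bool) :
    glue Λ η τ i = η i := by simp [glue, hi]

theorem glue_inf (Λ : Finset V) (η : Config V) (τ τ' : Λ → Bool) :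
    glue Λ η (τ ⊓ τ') = glue Λ η τ ⊓ glue Λ η τ' := by
  ext i
  by_cases hi : i ∈ Λ <;> simp [glue, hi]

theorem glue_sup (Λ : Finset V) (η : Config V) (τ τ' : Λ → Bool) :
    glue Λ η (τ ⊔ τ') = glue Λ η τ ⊔ glue Λ η τ' := by
  ext i
  by_cases hi : i ∈ Λ <;> simp [glue, hi]

theorem glue_mono (Λ : Finset V) (η : Config V) : Monotone (glue Λ η) := by
  intro τ τ' h i
  by_cases hi : i ∈ Λ
  · simpa [glue, hi] using h ⟨i, hi⟩
  · simp [glue, hi]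

theorem glue_restrict {Λ : Finset V} {η σ : Config V} (h : ∀ i ∉ Λ, σ i = η i) :
    glue Λ η (fun i => σ i) = σ := by
  ext i
  by_cases hi : i ∈ Λ <;> simp [glue, hi, h]

theorem restrict_glue (Λ : Finset V) (η : Config V) (τ : Λ → Bool) :
    (fun i : Λ => glue Λ η τ i) = τ := by
  ext ⟨i, hi⟩
  simp [glue, hi]

variable (G : SimpleGraph V) [G.LocallyFinite]

/-- The exponent `∑_e K_e σ_e + ∑_{i ∈ Λ} h_i σ_i` of the Boltzmann weight in `Λ`, for couplings
`K` that may depend on the bond. -/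
def exponent (K : Sym2 V → ℝ) (h : V → ℝ) (Λ : Finset V) (σ : Config V) : ℝ :=
  ∑ e ∈ bondsMeeting G Λ, K e * bondSpin σ e + ∑ i ∈ Λ, h i * spin σ i

/-- The unnormalized expectation of `f` in `Λ` with boundary condition `+`. -/
def plusSum (K : Sym2 V → ℝ) (h : V → ℝ) (Λ : Finset V) (f : Config V → ℝ) : ℝ :=
  ∑ τ : Λ → Bool, Real.exp (exponent G K h Λ (glue Λ (constBC V true) τ)) *
    f (glue Λ (constBC V true) τ)

/-- The expectation of `f` in `Λ` with boundary condition `+`. -/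
def plusMean (K : Sym2 V → ℝ) (h : V → ℝ) (Λ : Finset V) (f : Config V → ℝ) : ℝ :=
  plusSum G K h Λ f / plusSum G K h Λ 1

variable (K : Sym2 V → ℝ) (h : V → ℝ)

theorem plusSum_one_pos (Λ : Finset V) : 0 < plusSum G K h Λ 1 :=
  Finset.sum_pos (fun _ _ => by simpa using Real.exp_pos _) Finset.univ_nonempty

theorem plusMean_one (Λ : Finset V) : plusMean G K h Λ 1 = 1 :=
  div_self (plusSum_one_pos G K h Λ).ne'

theorem plusMean_add (Λ : Finset V) (f g : Config V → ℝ) :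
    plusMean G K h Λ (f + g) = plusMean G K h Λ f + plusMean G K h Λ g := by
  simp only [plusMean, plusSum, Pi.add_apply, mul_add, Finset.sum_add_distrib, add_div]

theorem plusMean_smul (Λ : Finset V) (c : ℝ) (f : Config V → ℝ) :
    plusMean G K h Λ (c • f) = c * plusMean G K h Λ f := by
  simp only [plusMean, plusSum, Pi.smul_apply, smul_eq_mul, mul_left_comm _ c, ← Finset.mul_sum,
    mul_div_assoc]

theorem plusSum_mono (Λ : Finset V) {f g : Config V → ℝ} (hfg : ∀ σ, f σ ≤ g σ) :
    plusSum G K h Λ f ≤ plusSum G K h Λ g :=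
  Finset.sum_le_sum fun _ _ => mul_le_mul_of_nonneg_left (hfg _) (Real.exp_pos _).le

theorem plusMean_mono (Λ : Finset V) {f g : Config V → ℝ} (hfg : ∀ σ, f σ ≤ g σ) :
    plusMean G K h Λ f ≤ plusMean G K h Λ g :=
  div_le_div_of_nonneg_right (plusSum_mono G K h Λ hfg) (plusSum_one_pos G K h Λ).le

theorem abs_plusMean_le (Λ : Finset V) {f : Config V → ℝ} {c : ℝ} (hf : ∀ σ, |f σ| ≤ c) :
    |plusMean G K h Λ f| ≤ c := by
  have h1 := plusMean_mono G K h Λ (f := f) (g := c • 1)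
    fun σ => by simpa using (abs_le.1 (hf σ)).2
  have h2 := plusMean_mono G K h Λ (f := (-c) • 1) (g := f)
    fun σ => by simpa using (abs_le.1 (hf σ)).1
  rw [plusMean_smul, plusMean_one] at h1 h2
  exact abs_le.2 ⟨by linarith, by linarith⟩

/-- The field term is modular and contributes an equality, so the sign of `h` plays no role. This is
what allows the `-` state to be handled through the field `-h`. -/
theorem exponent_supermodular (hK : ∀ e, 0 ≤ K e) (Λ : Finset V) (σ τ : Config V) :
    exponent G K h Λ σ + exponent G K h Λ τ ≤
      exponent G K h Λ (σ ⊓ τ) + exponent G K h Λ (σ ⊔ τ) := by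
  simp only [exponent]
  have h1 : ∑ e ∈ bondsMeeting G Λ, K e * bondSpin σ e +
      ∑ e ∈ bondsMeeting G Λ, K e * bondSpin τ e ≤
      ∑ e ∈ bondsMeeting G Λ, K e * bondSpin (σ ⊓ τ) e +
      ∑ e ∈ bondsMeeting G Λ, K e * bondSpin (σ ⊔ τ) e := by
    simp only [← Finset.sum_add_distrib, ← mul_add]
    exact Finset.sum_le_sum fun e _ => mul_le_mul_of_nonneg_left (bondSpin_add_le σ τ e) (hK e)
  have h2 : ∑ i ∈ Λ, h i * spin σ i + ∑ i ∈ Λ, h i * spin τ i =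
      ∑ i ∈ Λ, h i * spin (σ ⊓ τ) i + ∑ i ∈ Λ, h i * spin (σ ⊔ τ) i := by
    simp only [← Finset.sum_add_distrib, ← mul_add, spin_inf_add_spin_sup]
  linarith

/-- The FKG inequality for the unnormalized expectations. -/
theorem plusSum_fkg (hK : ∀ e, 0 ≤ K e) (Λ : Finset V) {f g : Config V → ℝ}
    (hf₀ : 0 ≤ f) (hg₀ : 0 ≤ g) (hf : Monotone f) (hg : Monotone g) :
    plusSum G K h Λ f * plusSum G K h Λ g ≤ plusSum G K h Λ 1 * plusSum G K h Λ (f * g) := by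
  have := fkg (μ := fun τ : Λ → Bool => Real.exp (exponent G K h Λ (glue Λ (constBC V true) τ)))
    (f := fun τ => f (glue Λ (constBC V true) τ)) (g := fun τ => g (glue Λ (constBC V true) τ))
    (fun _ => (Real.exp_pos _).le) (fun _ => hf₀ _) (fun _ => hg₀ _)
    (hf.comp (glue_mono _ _)) (hg.comp (glue_mono _ _)) fun a b => by
      simp only [← Real.exp_add, glue_inf, glue_sup]
      exact Real.exp_le_exp.2 (exponent_supermodular G K h hK Λ _ _)
  simpa [plusSum] using this

/-- A product of two spins is not increasing, but it is a combination of increasing indicators. -/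
theorem spin_mul_spin_eq_plusInd (i j : V) : (fun σ : Config V => spin σ i * spin σ j) =
    (4 : ℝ) • plusInd {i, j} + (-2 : ℝ) • plusInd {i} + (-2 : ℝ) • plusInd {j} + 1 := by
  ext σ
  simp only [spin, plusInd, Pi.add_apply, Pi.smul_apply, Finset.mem_singleton, forall_eq,
    Finset.mem_insert, forall_eq_or_imp]
  cases σ i <;> cases σ j <;> norm_num

/-- Conditioning on `+` in `Λ' \ Λ` turns the expectation in `Λ'` into the one in `Λ`. -/
theorem plusSum_mul_plusInd {Λ Λ' : Finset V} (hΛ : Λ ⊆ Λ') :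
    ∃ c : ℝ, 0 < c ∧ ∀ f : Config V → ℝ,
      plusSum G K h Λ' (f * plusInd (Λ' \ Λ)) = c * plusSum G K h Λ f := by
  have hb : bondsMeeting G Λ ⊆ bondsMeeting G Λ' := Finset.biUnion_subset_biUnion_of_subset_left _ hΛ
  -- A bond that meets `Λ'` but not `Λ` has both ends outside `Λ`, where every spin is `+`. The
  -- extra bonds and sites thus contribute this constant factor.
  refine ⟨Real.exp (∑ e ∈ bondsMeeting G Λ' \ bondsMeeting G Λ, K e + ∑ i ∈ Λ' \ Λ, h i),
    Real.exp_pos _, fun f => ?_⟩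
  have hexp : ∀ σ : Config V, (∀ i ∉ Λ, σ i = true) → exponent G K h Λ' σ =
      (∑ e ∈ bondsMeeting G Λ' \ bondsMeeting G Λ, K e + ∑ i ∈ Λ' \ Λ, h i) +
        exponent G K h Λ σ := by
    intro σ hσ
    have h1 : ∑ e ∈ bondsMeeting G Λ' \ bondsMeeting G Λ, K e * bondSpin σ e =
        ∑ e ∈ bondsMeeting G Λ' \ bondsMeeting G Λ, K e := by
      refine Finset.sum_congr rfl fun e he => ?_
      rw [Finset.mem_sdiff, mem_bondsMeeting, mem_bondsMeeting] at he
      obtain ⟨⟨he1, -⟩, he2⟩ := he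
      induction e with | _ i j
      have hi : i ∉ Λ := fun hi => he2 ⟨he1, i, hi, by simp⟩
      have hj : j ∉ Λ := fun hj => he2 ⟨he1, j, hj, by simp⟩
      simp [bondSpin, spin_of_true (hσ i hi), spin_of_true (hσ j hj)]
    have h2 : ∑ i ∈ Λ' \ Λ, h i * spin σ i = ∑ i ∈ Λ' \ Λ, h i :=
      Finset.sum_congr rfl fun i hi => by
        rw [spin_of_true (hσ i (Finset.mem_sdiff.1 hi).2), mul_one]
    simp only [exponent]
    rw [← Finset.sum_sdiff hb, ← Finset.sum_sdiff hΛ, h1, h2]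
    ring
  have h0 : ∀ τ : Λ' → Bool, plusInd (Λ' \ Λ) (glue Λ' (constBC V true) τ) ≠ 0 →
      ∀ i ∉ Λ, glue Λ' (constBC V true) τ i = true := by
    intro τ hτ i hi
    by_cases hi' : i ∈ Λ'
    · by_contra hne
      exact hτ (if_neg fun hall => hne (hall i (Finset.mem_sdiff.2 ⟨hi', hi⟩)))
    · rw [glue_of_notMem hi']; rfl
  have hout : ∀ τ : Λ → Bool, ∀ i ∉ Λ, glue Λ (constBC V true) τ i = true :=
    fun τ i hi => by rw [glue_of_notMem hi]; rfl
  have hback : ∀ τ : Λ → Bool, glue Λ' (constBC V true)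
      (fun i => glue Λ (constBC V true) τ i) = glue Λ (constBC V true) τ :=
    fun τ => glue_restrict fun i hi => hout τ i fun hi' => hi (hΛ hi')
  rw [plusSum, plusSum, Finset.mul_sum]
  symm
  -- Configurations in `Λ`, extended by `+`, inject into those in `Λ'`; the terms outside the image
  -- are killed by the indicator.
  refine Finset.sum_of_injOn (fun τ i => glue Λ (constBC V true) τ i) ?_ (by simp) ?_ ?_
  · intro τ _ τ' _ heq
    have := congrArg (glue Λ' (constBC V true)) heq
    simp only [hback] at this
    rw [← restrict_glue Λ (constBC V true) τ, this, restrict_glue]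
  · intro τ _ hτ
    by_contra hne
    have hne' : plusInd (Λ' \ Λ) (glue Λ' (constBC V true) τ) ≠ 0 :=
      fun h0 => hne (by simp [h0])
    refine hτ ⟨fun i => glue Λ' (constBC V true) τ i, by simp, ?_⟩
    have := glue_restrict (Λ := Λ) (η := constBC V true) (h0 τ hne')
    change (fun i : Λ' => glue Λ (constBC V true)
      (fun i => glue Λ' (constBC V true) τ i) i) = τ
    rw [this, restrict_glue]
  · intro τ _
    simp only [hback]
    rw [hexp _ (hout τ), Real.exp_add _ (exponent G K h Λ _), Pi.mul_apply, plusInd,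
      if_pos fun i hi => hout τ i (Finset.mem_sdiff.1 hi).2, mul_one, mul_assoc]

/-- The smaller volume is the larger one conditioned on `+` in `Λ' \ Λ`, an increasing event; by FKG
the conditioning can only raise the mean of `f`. -/
theorem plusMean_antitone (hK : ∀ e, 0 ≤ K e) {f : Config V → ℝ} (hf₀ : 0 ≤ f)
    (hf : Monotone f) : Antitone fun Λ => plusMean G K h Λ f := by
  intro Λ Λ' hΛ
  obtain ⟨c, hc, hcf⟩ := plusSum_mul_plusInd G K h hΛ
  have h1 := hcf 1
  rw [one_mul] at h1
  have := plusSum_fkg G K h hK Λ' hf₀ (plusInd_nonneg (Λ' \ Λ)) hf (plusInd_mono _)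
  rw [hcf f, h1] at this
  simp only [plusMean]
  rw [div_le_div_iff₀ (plusSum_one_pos _ _ _ _) (plusSum_one_pos _ _ _ _)]
  refine le_of_mul_le_mul_left ?_ hc
  linarith

/-- The limit of the expectations of `f` with boundary condition `+`. -/
def plusLimit (f : Config V → ℝ) : ℝ := limUnder atTop fun Λ => plusMean G K h Λ f

theorem tendsto_plusInd (hK : ∀ e, 0 ≤ K e) (A : Finset V) :
    Tendsto (fun Λ => plusMean G K h Λ (plusInd A)) atTop
      (𝓝 (⨅ Λ, plusMean G K h Λ (plusInd A))) := by
  refine tendsto_atTop_ciInf (plusMean_antitone G K h hK (plusInd_nonneg A) (plusInd_mono A))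
    ⟨-1, ?_⟩
  rintro _ ⟨Λ, rfl⟩
  refine (abs_le.1 (abs_plusMean_le G K h Λ fun σ => ?_)).1
  rw [abs_of_nonneg (plusInd_nonneg A σ)]
  exact plusInd_le_one A σ

/-- The limit is an infimum, hence a lower bound in every finite volume, including boxes not centred
at `A`. -/
theorem plusLimit_plusInd_le (hK : ∀ e, 0 ≤ K e) (A : Finset V) (Λ : Finset V) :
    plusLimit G K h (plusInd A) ≤ plusMean G K h Λ (plusInd A) := by
  rw [plusLimit, (tendsto_plusInd G K h hK A).limUnder_eq]
  refine ciInf_le ⟨-1, ?_⟩ Λ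
  rintro _ ⟨Λ, rfl⟩
  refine (abs_le.1 (abs_plusMean_le G K h Λ fun σ => ?_)).1
  rw [abs_of_nonneg (plusInd_nonneg A σ)]
  exact plusInd_le_one A σ

theorem tendsto_plusLimit_plusInd (hK : ∀ e, 0 ≤ K e) (A : Finset V) :
    Tendsto (fun Λ => plusMean G K h Λ (plusInd A)) atTop
      (𝓝 (plusLimit G K h (plusInd A))) :=
  tendsto_nhds_limUnder ⟨_, tendsto_plusInd G K h hK A⟩

/-! ### Translation invariance -/

theorem bondsMeeting_map (φ : G ≃g G) (Λ : Finset V) :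
    bondsMeeting G (Λ.map φ.toEquiv.toEmbedding) =
      (bondsMeeting G Λ).map (φ.toEquiv.toEmbedding.sym2Map) := by
  ext e
  simp only [Finset.mem_map, mem_bondsMeeting]
  constructor
  · rintro ⟨he, _, ⟨i, hi, rfl⟩, hie⟩
    refine ⟨e.map φ.symm, ⟨?_, i, hi, ?_⟩, ?_⟩
    · induction e with | _ a b
      exact φ.symm.map_adj_iff.2 he
    · rw [Sym2.mem_map]
      exact ⟨_, hie, by simp⟩
    · induction e with | _ a b
      simp
  · rintro ⟨e, ⟨he, i, hi, hie⟩, rfl⟩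
    refine ⟨?_, φ i, ⟨i, hi, rfl⟩, ?_⟩
    · induction e with | _ a b
      exact φ.map_adj_iff.2 he
    · exact Sym2.mem_map.2 ⟨i, hie, rfl⟩

theorem exponent_map (φ : G ≃g G) (hKφ : ∀ e : Sym2 V, K (e.map φ) = K e)
    (hhφ : ∀ i, h (φ i) = h i) (Λ : Finset V) (σ : Config V) :
    exponent G K h (Λ.map φ.toEquiv.toEmbedding) σ = exponent G K h Λ (σ ∘ φ) := by
  simp only [exponent, bondsMeeting_map, Finset.sum_map]
  congr 1
  · refine Finset.sum_congr rfl fun e _ => ?_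
    change K (e.map φ) * bondSpin σ (e.map φ) = _
    rw [hKφ, bondSpin_map]
  · exact Finset.sum_congr rfl fun i _ => by
      change h (φ i) * spin σ (φ i) = _
      rw [hhφ]; rfl

/-- The constant boundary condition is fixed by every automorphism, so only the couplings and the
field need to be invariant. -/
theorem plusSum_map (φ : G ≃g G) (hKφ : ∀ e : Sym2 V, K (e.map φ) = K e)
    (hhφ : ∀ i, h (φ i) = h i) (Λ : Finset V) (f : Config V → ℝ) :
    plusSum G K h (Λ.map φ.toEquiv.toEmbedding) f = plusSum G K h Λ fun σ => f (σ ∘ φ.symm) := by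
  have key : ∀ τ : Λ.map φ.toEquiv.toEmbedding → Bool,
      glue _ (constBC V true) τ ∘ φ = glue Λ (constBC V true)
        fun i => glue _ (constBC V true) τ (φ i) := by
    intro τ
    refine (glue_restrict (σ := glue _ (constBC V true) τ ∘ φ) fun i hi => ?_).symm
    simp only [Function.comp]
    rw [glue_of_notMem]
    · rfl
    · exact fun hmem => hi ((Finset.mem_map' _).1 hmem)
  refine Finset.sum_bij' (fun τ _ i => glue _ (constBC V true) τ (φ i))
    (fun τ _ i => glue _ (constBC V true) τ (φ.symm i)) (by simp) (by simp) ?_ ?_ ?_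
  · intro τ _
    ext i
    rw [← key τ]
    simp [glue_of_mem i.2]
  · intro τ _
    ext i
    have hi : φ i ∈ Λ.map φ.toEquiv.toEmbedding := (Finset.mem_map' _).2 i.2
    rw [glue_of_mem hi]
    change glue Λ _ τ (φ.symm (φ i)) = τ i
    rw [φ.symm_apply_apply, glue_of_mem i.2]
  · intro τ _
    rw [exponent_map G K h φ hKφ hhφ, ← key τ]
    congr 2
    ext i
    simp

theorem plusMean_map (φ : G ≃g G) (hKφ : ∀ e : Sym2 V, K (e.map φ) = K e)
    (hhφ : ∀ i, h (φ i) = h i) (Λ : Finset V) (f : Config V → ℝ) :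
    plusMean G K h (Λ.map φ.toEquiv.toEmbedding) f =
      plusMean G K h Λ fun σ => f (σ ∘ φ.symm) := by
  simp only [plusMean, plusSum_map G K h φ hKφ hhφ]
  rfl

theorem plusMean_map_plusInd (φ : G ≃g G) (hKφ : ∀ e : Sym2 V, K (e.map φ) = K e)
    (hhφ : ∀ i, h (φ i) = h i) (Λ A : Finset V) :
    plusMean G K h (Λ.map φ.toEquiv.toEmbedding) (plusInd (A.map φ.toEquiv.toEmbedding)) =
      plusMean G K h Λ (plusInd A) := by
  rw [plusMean_map G K h φ hKφ hhφ]
  congr 1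
  exact plusInd_comp_symm φ.toEquiv A

end General

/-! ### Infinite-volume states -/

section States

variable {V : Type*}

theorem continuous_spin (i : V) : Continuous fun σ : Config V => spin σ i :=
  (continuous_of_discreteTopology (f := fun b : Bool => if b then (1 : ℝ) else -1)).comp
    (continuous_apply i)

theorem plusInd_eq_prod (A : Finset V) (σ : Config V) :
    plusInd A σ = ∏ i ∈ A, if σ i then (1 : ℝ) else 0 := by
  rw [plusInd, Finset.prod_ite_zero]
  simp

theorem continuous_plusInd (A : Finset V) : Continuous (plusInd A) := by
  have : plusInd A = fun σ : Config V => ∏ i ∈ A, if σ i then (1 : ℝ) else 0 :=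
    funext (plusInd_eq_prod A)
  rw [this]
  exact continuous_finsetProd _ fun i _ =>
    (continuous_of_discreteTopology (f := fun b : Bool => if b then (1 : ℝ) else 0)).comp
    (continuous_apply i)

theorem tendsto_integral_of_tendsto [Countable V] {ι : Type*} {l : Filter ι}
    {μ : ι → ProbabilityMeasure (Config V)} {ν : ProbabilityMeasure (Config V)}
    (hμ : Tendsto μ l (𝓝 ν)) {f : Config V → ℝ} (hf : Continuous f) :
    Tendsto (fun i => ∫ σ, f σ ∂(μ i : Measure (Config V))) l
      (𝓝 (∫ σ, f σ ∂(ν : Measure (Config V)))) :=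
  ProbabilityMeasure.tendsto_iff_forall_integral_tendsto.1 hμ
    (BoundedContinuousFunction.mkOfCompact ⟨f, hf⟩)

/-- A probability measure on configurations is determined by the probabilities of the events
that all spins in a finite set are `+`. -/
theorem probabilityMeasure_ext_plusInd [Countable V] {μ ν : ProbabilityMeasure (Config V)}
    (h : ∀ A : Finset V, ∫ σ, plusInd A σ ∂(μ : Measure (Config V)) =
      ∫ σ, plusInd A σ ∂(ν : Measure (Config V))) : μ = ν := by
  classical
  have hmeas : ∀ A : Finset V, MeasurableSet {σ : Config V | ∀ i ∈ A, σ i = true} := fun A => by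
    have : {σ : Config V | ∀ i ∈ A, σ i = true} = ⋂ i ∈ A, (fun σ => σ i) ⁻¹' {true} := by
      ext; simp
    rw [this]
    exact Finset.measurableSet_biInter _ fun i _ => measurable_pi_apply i (by trivial)
  have hint : ∀ (ρ : ProbabilityMeasure (Config V)) (A : Finset V),
      ∫ σ, plusInd A σ ∂(ρ : Measure (Config V)) =
        (ρ : Measure (Config V)).real {σ : Config V | ∀ i ∈ A, σ i = true} := fun ρ A => by
    rw [← integral_indicator_one (hmeas A)]
    congr 1
    ext σ
    simp [plusInd, Set.indicator]
  refine ProbabilityMeasure.toMeasure_injective (ext_of_generate_finite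
    (Set.range fun A : Finset V => {σ : Config V | ∀ i ∈ A, σ i = true}) ?_ ?_ ?_ (by simp))
  · refine le_antisymm ?_ (MeasurableSpace.generateFrom_le ?_)
    · refine iSup_le fun i => ?_
      rw [← measurable_iff_comap_le]
      refine measurable_to_bool ?_
      refine MeasurableSpace.measurableSet_generateFrom ⟨{i}, ?_⟩
      ext; simp
    · rintro _ ⟨A, rfl⟩
      exact hmeas A
  -- These events form a π-system: the intersection of those of `A` and `B` is that of `A ∪ B`.
  · rintro _ ⟨A, rfl⟩ _ ⟨B, rfl⟩ _
    refine ⟨A ∪ B, ?_⟩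
    ext σ
    simp only [Finset.mem_union, Set.mem_ofPred_eq, Set.mem_inter_iff]
    exact ⟨fun H => ⟨fun i hi => H i (.inl hi), fun i hi => H i (.inr hi)⟩,
      fun H i hi => hi.elim (H.1 i) (H.2 i)⟩
  · rintro _ ⟨A, rfl⟩
    have := h A
    rw [hint, hint] at this
    exact (measureReal_eq_measureReal_iff).1 this

/-- Probability measures on configurations converge weakly as soon as the probabilities of the
events that all spins in a finite set are `+` converge. -/
theorem exists_tendsto_of_plusInd [Countable V] {ι : Type*} {l : Filter ι} [l.NeBot]
    {μ : ι → ProbabilityMeasure (Config V)} {c : Finset V → ℝ}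
    (h : ∀ A : Finset V, Tendsto (fun i => ∫ σ, plusInd A σ ∂(μ i : Measure (Config V))) l
      (𝓝 (c A))) : ∃ ν, Tendsto μ l (𝓝 ν) := by
  -- The space of probability measures is compact, so convergence follows once every cluster point
  -- is shown to have the values `c A`, which determine it.
  have key : ∀ ν : ProbabilityMeasure (Config V), ClusterPt ν (l.map μ) →
      ∀ A, ∫ σ, plusInd A σ ∂(ν : Measure (Config V)) = c A := by
    intro ν hν A
    have hcl := mapClusterPt_iff_ultrafilter.1 hν
    obtain ⟨U, hU, hUν⟩ := hcl
    exact tendsto_nhds_unique (tendsto_integral_of_tendsto hUν (continuous_plusInd A))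
      ((h A).mono_left hU)
  obtain ⟨ν, hν⟩ := exists_clusterPt_of_compactSpace (l.map μ)
  exact ⟨ν, le_nhds_of_unique_clusterPt fun ν' hν' =>
    probabilityMeasure_ext_plusInd fun A => (key ν' hν' A).trans (key ν hν A).symm⟩

/-- The global spin flip. -/
def spinFlip (σ : Config V) : Config V := fun i => !σ i

theorem spin_spinFlip (σ : Config V) (i : V) : spin (spinFlip σ) i = -spin σ i := by
  rcases (σ i).eq_false_or_eq_true with h | h <;> simp [spin, spinFlip, h]

theorem bondSpin_spinFlip (σ : Config V) (e : Sym2 V) :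
    bondSpin (spinFlip σ) e = bondSpin σ e := by
  induction e with | _ i j
  simp [bondSpin, spin_spinFlip]

theorem continuous_spinFlip : Continuous (spinFlip : Config V → Config V) :=
  continuous_pi fun i => continuous_of_discreteTopology.comp (continuous_apply i)

/-! ### Existence of the states, and reduction of `-` to `+` by the spin flip -/

variable [DecidableEq V] (G : SimpleGraph V) [G.LocallyFinite]

theorem neg_hamiltonian (J : ℝ) (h : V → ℝ) (Λ : Finset V) (σ : Config V) :
    -hamiltonian G J h Λ σ = exponent G (fun _ => J) h Λ σ := by
  simp only [hamiltonian, exponent]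
  ring

theorem partitionFunction_plus (J : ℝ) (h : V → ℝ) (Λ : Finset V) :
    partitionFunction G J h Λ (constBC V true) = plusSum G (fun _ => J) h Λ 1 := by
  simp [partitionFunction, plusSum, neg_hamiltonian]

theorem integral_gibbs_plus [Countable V] (J : ℝ) (h : V → ℝ) (Λ : Finset V)
    {f : Config V → ℝ} (hf : Continuous f) :
    ∫ σ, f σ ∂(gibbs G J h (constBC V true) Λ : Measure (Config V)) =
      plusMean G (fun _ => J) h Λ f := by
  change ∫ σ, f σ ∂(gibbsMeasure G J h Λ (constBC V true)) = _
  rw [gibbsMeasure, integral_finsetSum_measure]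
  · simp only [integral_smul_measure, integral_dirac' _ _ hf.stronglyMeasurable,
      partitionFunction_plus, neg_hamiltonian]
    rw [plusMean, plusSum.eq_1 G _ h Λ f, Finset.sum_div]
    refine Finset.sum_congr rfl fun τ _ => ?_
    rw [ENNReal.toReal_ofReal (div_nonneg (Real.exp_pos _).le (plusSum_one_pos _ _ _ _).le)]
    rw [smul_eq_mul, div_mul_eq_mul_div]
  · exact fun τ _ => ((integrable_dirac' hf.stronglyMeasurable (by simp)).smul_measure (by simp))

theorem exists_tendsto_gibbs_plus [Countable V] {J : ℝ} (hJ : 0 ≤ J) (h : V → ℝ) :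
    ∃ ν, Tendsto (gibbs G J h (constBC V true)) atTop (𝓝 ν) :=
  exists_tendsto_of_plusInd (c := fun A => plusLimit G (fun _ => J) h (plusInd A)) fun A => by
    simp only [integral_gibbs_plus G J h _ (continuous_plusInd A)]
    exact tendsto_plusLimit_plusInd G _ h (fun _ => hJ) A

theorem glue_minus (Λ : Finset V) (τ : Λ → Bool) :
    glue Λ (constBC V false) τ = spinFlip (glue Λ (constBC V true) fun i => !τ i) := by
  ext i
  by_cases hi : i ∈ Λ <;> simp [glue, spinFlip, hi, constBC]

/-- Bond terms are even under the flip and field terms are odd. -/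
theorem hamiltonian_spinFlip (J : ℝ) (h : V → ℝ) (Λ : Finset V) (σ : Config V) :
    hamiltonian G J h Λ (spinFlip σ) = hamiltonian G J (-h) Λ σ := by
  simp [hamiltonian, bondSpin_spinFlip, spin_spinFlip]

theorem sum_minus {M : Type*} [AddCommMonoid M] (Λ : Finset V) (F : Config V → M) :
    ∑ τ : Λ → Bool, F (glue Λ (constBC V false) τ) =
      ∑ τ : Λ → Bool, F (spinFlip (glue Λ (constBC V true) τ)) := by
  simp only [glue_minus]
  exact (Equiv.piCongrRight fun _ : Λ => Equiv.boolNot).sum_comp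
    fun τ => F (spinFlip (glue Λ (constBC V true) τ))

theorem partitionFunction_minus (J : ℝ) (h : V → ℝ) (Λ : Finset V) :
    partitionFunction G J h Λ (constBC V false) =
      partitionFunction G J (-h) Λ (constBC V true) := by
  rw [partitionFunction,
    sum_minus (F := fun σ => Real.exp (-hamiltonian G J h Λ σ)) (Λ := Λ)]
  simp only [hamiltonian_spinFlip, partitionFunction]

theorem gibbs_minus [Countable V] (J : ℝ) (h : V → ℝ) (Λ : Finset V) :
    gibbs G J h (constBC V false) Λ =
      (gibbs G J (-h) (constBC V true) Λ).map continuous_spinFlip.measurable.aemeasurable := by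
  refine ProbabilityMeasure.toMeasure_injective ?_
  rw [ProbabilityMeasure.toMeasure_map]
  change gibbsMeasure _ _ _ _ _ = (gibbsMeasure _ _ _ _ _).map _
  ext s hs
  rw [Measure.map_apply continuous_spinFlip.measurable hs]
  simp only [gibbsMeasure, partitionFunction_minus]
  rw [sum_minus (F := fun σ => ENNReal.ofReal (Real.exp (-hamiltonian G J h Λ σ) /
    partitionFunction G J (-h) Λ (constBC V true)) • Measure.dirac σ) (Λ := Λ)]
  simp [hamiltonian_spinFlip, Measure.dirac_apply' _ hs,
    Measure.dirac_apply' _ (continuous_spinFlip.measurable hs), Set.indicator]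
  rfl

theorem exists_tendsto_gibbs [Countable V] {J : ℝ} (hJ : 0 ≤ J) (h : V → ℝ) (b : Bool) :
    ∃ ν, Tendsto (gibbs G J h (constBC V b)) atTop (𝓝 ν) := by
  cases b
  · obtain ⟨ν, hν⟩ := exists_tendsto_gibbs_plus G hJ (-h)
    rw [funext (gibbs_minus G J h)]
    exact ⟨_, ProbabilityMeasure.tendsto_map_of_tendsto_of_continuous _ _ hν continuous_spinFlip⟩
  · exact exists_tendsto_gibbs_plus G hJ h

theorem tendsto_gibbs_infiniteState [Countable V] {J : ℝ} (hJ : 0 ≤ J) (h : V → ℝ) (b : Bool) :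
    Tendsto (gibbs G J h (constBC V b)) atTop (𝓝 (infiniteState G J h (constBC V b))) :=
  tendsto_nhds_limUnder (exists_tendsto_gibbs G hJ h b)

theorem tendsto_plusMean_spin [Countable V] {J : ℝ} (hJ : 0 ≤ J) (h : V → ℝ) (i : V) :
    Tendsto (fun Λ => plusMean G (fun _ => J) h Λ fun σ => spin σ i) atTop
      (𝓝 (magnetization (infiniteState G J h (constBC V true)) i)) := by
  simp only [← integral_gibbs_plus G J h _ (continuous_spin i)]
  exact tendsto_integral_of_tendsto (tendsto_gibbs_infiniteState G hJ h true) (continuous_spin i)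

theorem magnetization_minus [Countable V] {J : ℝ} (hJ : 0 ≤ J) (h : V → ℝ) (i : V) :
    magnetization (infiniteState G J h (constBC V false)) i =
      -magnetization (infiniteState G J (-h) (constBC V true)) i := by
  refine tendsto_nhds_unique (tendsto_integral_of_tendsto
    (tendsto_gibbs_infiniteState G hJ h false) (continuous_spin i)) ?_
  refine (tendsto_plusMean_spin G hJ (-h) i).neg.congr fun Λ => ?_
  rw [gibbs_minus, ProbabilityMeasure.toMeasure_map,
    integral_map continuous_spinFlip.measurable.aemeasurable
      (continuous_spin i).aestronglyMeasurable]
  simp only [spin_spinFlip, integral_neg, integral_gibbs_plus G J (-h) Λ (continuous_spin i)]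

end States

/-! ### Derivatives of logarithms of partition functions -/

section LogSumExp

variable {T : Type*} [Fintype T] [Nonempty T] (a b : T → ℝ)

theorem sum_exp_pos (s : ℝ) : 0 < ∑ t, Real.exp (a t + s * b t) :=
  Finset.sum_pos (fun _ _ => Real.exp_pos _) Finset.univ_nonempty

theorem continuous_mean_exp : Continuous fun s : ℝ =>
    (∑ t, Real.exp (a t + s * b t) * b t) / ∑ t, Real.exp (a t + s * b t) := by
  refine Continuous.div ?_ ?_ fun s => (sum_exp_pos a b s).ne' <;> fun_prop

/-- The logarithmic derivative of a sum of exponentials is the Gibbs mean of `b`. It is used twice: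
for the field strength and for the crossing couplings. -/
theorem log_sum_exp_sub (r : ℝ) :
    Real.log (∑ t, Real.exp (a t + r * b t)) - Real.log (∑ t, Real.exp (a t)) =
      ∫ s in (0 : ℝ)..r,
        (∑ t, Real.exp (a t + s * b t) * b t) / ∑ t, Real.exp (a t + s * b t) := by
  have h := intervalIntegral.integral_eq_sub_of_hasDerivAt (a := 0) (b := r)
    (f := fun s => Real.log (∑ t, Real.exp (a t + s * b t)))
    (f' := fun s => (∑ t, Real.exp (a t + s * b t) * b t) / ∑ t, Real.exp (a t + s * b t))
    (fun s _ => ?_) ((continuous_mean_exp a b).intervalIntegrable _ _)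
  · rw [h]; simp
  · refine HasDerivAt.log (HasDerivAt.fun_sum fun t _ => ?_) (sum_exp_pos a b s).ne'
    simpa using (((hasDerivAt_id s).mul_const (b t)).const_add (a t)).exp

end LogSumExp

/-! ### Averages over cubes -/

theorem card_baseCube (d n : ℕ) : (baseCube d n).card = (2 * n + 1) ^ (d - 1) := by
  have : ((n : ℤ) + 1 + n).toNat = 2 * n + 1 := by omega
  simp [baseCube, Pi.card_Icc, this]

theorem baseCube_mono (d : ℕ) : Monotone (baseCube d) := fun m n h =>
  Finset.Icc_subset_Icc (fun _ => by simpa using h) fun _ => by simpa using h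

theorem card_baseCube_pos (d n : ℕ) : (0 : ℝ) < (baseCube d n).card := by
  rw [card_baseCube]; positivity

/-- A boundary layer of fixed thickness `k` is a vanishing fraction of the cube. -/
theorem tendsto_card_baseCube_ratio (d k : ℕ) :
    Tendsto (fun n => ((baseCube d (n - k)).card : ℝ) / (baseCube d n).card) atTop (𝓝 1) := by
  have h1 : Tendsto (fun n : ℕ => 1 - (2 * (k : ℝ)) / (2 * n + 1)) atTop (𝓝 (1 - 0)) := by
    refine tendsto_const_nhds.sub (Tendsto.div_atTop tendsto_const_nhds ?_)
    exact tendsto_atTop_add_const_right _ _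
      (tendsto_natCast_atTop_atTop.const_mul_atTop (by norm_num))
  have h2 := h1.pow (d - 1)
  simp only [sub_zero, one_pow] at h2
  refine h2.congr' ?_
  filter_upwards [eventually_ge_atTop k] with n hn
  simp only [card_baseCube]
  push_cast [Nat.cast_sub hn]
  rw [← div_pow]
  congr 1
  field_simp
  ring

/-- If `a n x` lies above `L` in the cube of radius `n`, and below `u k` up to distance `k` from
the boundary of the cube, where `u k` tends to `L`, then the averages over cubes tend to `L`. -/
theorem tendsto_average {d : ℕ} {a : ℕ → (Fin (d - 1) → ℤ) → ℝ} {u : ℕ → ℝ} {L M : ℝ}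
    (hL : ∀ n x, L ≤ a n x) (hM : ∀ n x, a n x ≤ M)
    (hu : ∀ k n, k ≤ n → ∀ x ∈ baseCube d (n - k), a n x ≤ u k)
    (hlim : Tendsto u atTop (𝓝 L)) :
    Tendsto (fun n => (∑ x ∈ baseCube d n, a n x) / (baseCube d n).card) atTop (𝓝 L) := by
  rw [Metric.tendsto_atTop]
  intro ε hε
  -- First `k` is fixed to make the inner bound good; then `n` is taken large enough that the outer
  -- layer, bounded only by `M`, no longer matters.
  obtain ⟨k, hk⟩ := (hlim.eventually (gt_mem_nhds (show L < L + ε / 2 by linarith))).exists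
  have hB : Tendsto (fun n => (u k - M) * (((baseCube d (n - k)).card : ℝ) /
      (baseCube d n).card) + M) atTop (𝓝 ((u k - M) * 1 + M)) :=
    ((tendsto_card_baseCube_ratio d k).const_mul _).add_const _
  obtain ⟨N, hN⟩ := eventually_atTop.1 (hB.eventually
    (gt_mem_nhds (show (u k - M) * 1 + M < L + ε by linarith)))
  refine ⟨max N k, fun n hn => ?_⟩
  have hc := card_baseCube_pos d n
  have hlow : L ≤ (∑ x ∈ baseCube d n, a n x) / (baseCube d n).card := by
    rw [le_div_iff₀ hc]
    have := Finset.card_nsmul_le_sum (baseCube d n) (a n) L fun x _ => hL n x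
    rw [nsmul_eq_mul] at this
    linarith
  have hup : (∑ x ∈ baseCube d n, a n x) / (baseCube d n).card ≤
      (u k - M) * (((baseCube d (n - k)).card : ℝ) / (baseCube d n).card) + M := by
    have hsub : baseCube d (n - k) ⊆ baseCube d n := baseCube_mono d (Nat.sub_le n k)
    have h1 := Finset.sum_le_card_nsmul (baseCube d (n - k)) (a n) (u k)
      (hu k n (le_of_max_le_right hn))
    have h2 := Finset.sum_le_card_nsmul (baseCube d n \ baseCube d (n - k)) (a n) M
      fun x _ => hM n x
    have h3 := Finset.cast_card_sdiff (R := ℝ) hsub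
    have h4 := Finset.sum_sdiff hsub (f := a n)
    simp only [nsmul_eq_mul] at h1 h2
    rw [h3] at h2
    rw [div_le_iff₀ hc, add_mul, mul_assoc, div_mul_cancel₀ _ hc.ne']
    linarith
  rw [Real.dist_eq, abs_of_nonneg (by linarith)]
  have := hN n (le_of_max_le_left hn)
  linarith

/-! ### Averages of expectations over translates -/

section Translates

variable {V : Type*} [DecidableEq V] (G : SimpleGraph V) [G.LocallyFinite]

theorem plusMean_spin (K : Sym2 V → ℝ) (h : V → ℝ) (Λ : Finset V) (i : V) :
    plusMean G K h Λ (fun σ => spin σ i) = 2 * plusMean G K h Λ (plusInd {i}) - 1 := by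
  rw [spin_eq_plusInd, plusMean_add, plusMean_smul, plusMean_smul, plusMean_one]
  ring

theorem plusMean_spin_mul_spin (K : Sym2 V → ℝ) (h : V → ℝ) (Λ : Finset V) (i j : V) :
    plusMean G K h Λ (fun σ => spin σ i * spin σ j) = 4 * plusMean G K h Λ (plusInd {i, j}) -
      2 * plusMean G K h Λ (plusInd {i}) - 2 * plusMean G K h Λ (plusInd {j}) + 1 := by
  rw [spin_mul_spin_eq_plusInd, plusMean_add, plusMean_add, plusMean_add, plusMean_smul,
    plusMean_smul, plusMean_smul, plusMean_one]
  ring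

variable {K : Sym2 V → ℝ} {h : V → ℝ} {d : ℕ} {φ : (Fin (d - 1) → ℤ) → (G ≃g G)}
  {Λ : ℕ → Finset V}

/-- The term at `x` is squeezed between two consequences of volume monotonicity: it exceeds the
infinite-volume limit, and, away from the boundary, it is at most the mean in `Λ k` translated by
`x`. -/
theorem tendsto_average_plusInd (hK : ∀ e, 0 ≤ K e)
    (hKφ : ∀ x (e : Sym2 V), K (e.map (φ x)) = K e) (hhφ : ∀ x i, h (φ x i) = h i)
    (hΛ : Tendsto Λ atTop atTop)
    (hsub : ∀ k n, k ≤ n → ∀ x ∈ baseCube d (n - k),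
      (Λ k).map (φ x).toEquiv.toEmbedding ⊆ Λ n) (A : Finset V) :
    Tendsto (fun n => (∑ x ∈ baseCube d n,
      plusMean G K h (Λ n) (plusInd (A.map (φ x).toEquiv.toEmbedding))) / (baseCube d n).card)
      atTop (𝓝 (plusLimit G K h (plusInd A))) := by
  refine tendsto_average (u := fun k => plusMean G K h (Λ k) (plusInd A)) (M := 1)
    (fun n x => ?_) (fun n x => ?_) (fun k n hkn x hx => ?_)
    ((tendsto_plusLimit_plusInd G K h hK A).comp hΛ)
  -- Translating back by `x` moves `A` to a fixed place and only shifts the box, and the infimum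
  -- bounds every box.
  · have : ((Λ n).map (φ x).symm.toEquiv.toEmbedding).map (φ x).toEquiv.toEmbedding = Λ n := by
      ext i
      simp only [Finset.mem_map_equiv]
      change (φ x) ((φ x).symm i) ∈ Λ n ↔ _
      rw [RelIso.apply_symm_apply]
    rw [← this, plusMean_map_plusInd G K h (φ x) (hKφ x) (hhφ x)]
    exact plusLimit_plusInd_le G K h hK A _
  · refine (abs_le.1 (abs_plusMean_le G K h _ fun σ => ?_)).2
    rw [abs_of_nonneg (plusInd_nonneg _ σ)]
    exact plusInd_le_one _ σ
  · rw [← plusMean_map_plusInd G K h (φ x) (hKφ x) (hhφ x) (Λ k) A]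
    exact plusMean_antitone G K h hK (plusInd_nonneg _) (plusInd_mono _) (hsub k n hkn x hx)

theorem tendsto_average_spin (hK : ∀ e, 0 ≤ K e)
    (hKφ : ∀ x (e : Sym2 V), K (e.map (φ x)) = K e) (hhφ : ∀ x i, h (φ x i) = h i)
    (hΛ : Tendsto Λ atTop atTop)
    (hsub : ∀ k n, k ≤ n → ∀ x ∈ baseCube d (n - k),
      (Λ k).map (φ x).toEquiv.toEmbedding ⊆ Λ n) (i : V) :
    Tendsto (fun n => (∑ x ∈ baseCube d n,
      plusMean G K h (Λ n) fun σ => spin σ (φ x i)) / (baseCube d n).card)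
      atTop (𝓝 (2 * plusLimit G K h (plusInd {i}) - 1)) := by
  refine (((tendsto_average_plusInd G hK hKφ hhφ hΛ hsub {i}).const_mul 2).sub_const 1).congr
    fun n => ?_
  have := (card_baseCube_pos d n).ne'
  simp only [plusMean_spin, Finset.sum_sub_distrib, ← Finset.mul_sum, Finset.map_singleton,
    Finset.sum_const, nsmul_eq_mul, mul_one]
  rw [sub_div, div_self this, mul_div_assoc]
  rfl

theorem tendsto_average_spin_mul_spin (hK : ∀ e, 0 ≤ K e)
    (hKφ : ∀ x (e : Sym2 V), K (e.map (φ x)) = K e) (hhφ : ∀ x i, h (φ x i) = h i)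
    (hΛ : Tendsto Λ atTop atTop)
    (hsub : ∀ k n, k ≤ n → ∀ x ∈ baseCube d (n - k),
      (Λ k).map (φ x).toEquiv.toEmbedding ⊆ Λ n) (i j : V) :
    Tendsto (fun n => (∑ x ∈ baseCube d n,
      plusMean G K h (Λ n) fun σ => spin σ (φ x i) * spin σ (φ x j)) / (baseCube d n).card)
      atTop (𝓝 (4 * plusLimit G K h (plusInd {i, j}) - 2 * plusLimit G K h (plusInd {i}) -
        2 * plusLimit G K h (plusInd {j}) + 1)) := by
  have H := tendsto_average_plusInd G hK hKφ hhφ hΛ hsub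
  refine (((((H {i, j}).const_mul 4).sub ((H {i}).const_mul 2)).sub
    ((H {j}).const_mul 2)).add_const 1).congr fun n => ?_
  have := (card_baseCube_pos d n).ne'
  simp only [plusMean_spin_mul_spin, Finset.sum_sub_distrib, Finset.sum_add_distrib,
    ← Finset.mul_sum, Finset.map_singleton, Finset.map_insert,
    Finset.sum_const, nsmul_eq_mul, mul_one]
  rw [add_div, sub_div, sub_div, div_self this, mul_div_assoc, mul_div_assoc, mul_div_assoc]
  rfl

end Translates

/-! ### The half-space -/

section HalfSpace

variable {d : ℕ}

theorem mem_baseCube {n : ℕ} {x : Fin (d - 1) → ℤ} :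
    x ∈ baseCube d n ↔ ∀ k, -(n : ℤ) ≤ x k ∧ x k ≤ n := by
  simp only [baseCube, Finset.mem_Icc, Pi.le_def, forall_and]

theorem mem_halfBox {n : ℕ} {i : HalfSpace d} :
    i ∈ halfBox d n ↔ i.1.1 ∈ baseCube d n ∧ i.1.2 ≤ n := by
  simp [halfBox, box, i.2]

theorem add_mem_baseCube {k n : ℕ} (hkn : k ≤ n) {x y : Fin (d - 1) → ℤ}
    (hx : x ∈ baseCube d (n - k)) (hy : y ∈ baseCube d k) : y + x ∈ baseCube d n := by
  rw [mem_baseCube] at *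
  intro l
  have h1 := hx l
  have h2 := hy l
  push_cast [hkn] at h1
  simp only [Pi.add_apply]
  omega

theorem exists_mem_baseCube (x : Fin (d - 1) → ℤ) : ∃ n, x ∈ baseCube d n := by
  refine ⟨∑ k, (x k).natAbs, mem_baseCube.2 fun k => ?_⟩
  have := Finset.single_le_sum (f := fun k => (x k).natAbs) (fun k _ => Nat.zero_le _)
    (Finset.mem_univ k)
  omega

/-- The translation of the lattice by `x` in the directions of the wall. -/
def latticeShift (x : Fin (d - 1) → ℤ) : latticeGraph d ≃g latticeGraph d where
  toFun i := (i.1 + x, i.2)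
  invFun i := (i.1 - x, i.2)
  left_inv i := by simp
  right_inv i := by simp
  map_rel_iff' := by simp [latticeGraph]

/-- The translation of the half-space by `x` in the directions of the wall. -/
def halfSpaceShift (x : Fin (d - 1) → ℤ) : halfSpaceGraph d ≃g halfSpaceGraph d where
  toFun i := ⟨(i.1.1 + x, i.1.2), i.2⟩
  invFun i := ⟨(i.1.1 - x, i.1.2), i.2⟩
  left_inv i := by simp
  right_inv i := by simp
  map_rel_iff' := by simp [halfSpaceGraph, latticeGraph]

theorem tendsto_halfBox : Tendsto (halfBox d) atTop atTop := by
  refine tendsto_atTop_finset_of_monotone (fun m n hmn i hi => ?_) fun i => ?_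
  · rw [mem_halfBox] at *
    exact ⟨baseCube_mono d hmn hi.1, hi.2.trans (by exact_mod_cast hmn)⟩
  · obtain ⟨n, hn⟩ := exists_mem_baseCube i.1.1
    refine ⟨max n i.1.2.toNat, mem_halfBox.2 ⟨baseCube_mono d (le_max_left _ _) hn, ?_⟩⟩
    have := i.2
    have := le_max_right n i.1.2.toNat
    omega

theorem map_halfSpaceShift_subset {k n : ℕ} (hkn : k ≤ n) {x : Fin (d - 1) → ℤ}
    (hx : x ∈ baseCube d (n - k)) :
    (halfBox d k).map (halfSpaceShift x).toEquiv.toEmbedding ⊆ halfBox d n := by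
  intro i hi
  obtain ⟨j, hj, rfl⟩ := Finset.mem_map.1 hi
  rw [mem_halfBox] at hj ⊢
  exact ⟨add_mem_baseCube hkn hx hj.1, hj.2.trans (by exact_mod_cast hkn)⟩

/-- Slicing by height. The slices are written as an infinite series with a cutoff so that dominated
convergence for series applies as `n` grows. -/
theorem sum_halfBox (n : ℕ) (F : HalfSpace d → ℝ) :
    ∑ i ∈ halfBox d n, F i =
      ∑' ℓ : ℕ+, if (ℓ : ℕ) ≤ n then
        ∑ x ∈ baseCube d n, F (halfSpaceShift x (axisPoint d ℓ)) else 0 := by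
  -- The range ends at `n + 1` because `n` may be `0`, which is not in `ℕ+`; the cutoff makes the
  -- extra term vanish.
  rw [tsum_eq_sum (s := Finset.Icc 1 n.succPNat)]
  · rw [← Finset.sum_filter, Finset.sum_sigma']
    refine Finset.sum_bij' (fun i _ => (⟨⟨i.1.2.toNat, by have := i.2; omega⟩, i.1.1⟩ :
        Σ _ : ℕ+, (Fin (d - 1) → ℤ)))
      (fun p _ => halfSpaceShift p.2 (axisPoint d p.1)) ?_ ?_ ?_ ?_ ?_
    · intro i hi
      obtain ⟨h1, h2⟩ := mem_halfBox.1 hi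
      have h3 := i.2
      refine Finset.mem_sigma.2 ⟨Finset.mem_filter.2 ⟨Finset.mem_Icc.2 ⟨one_le, ?_⟩, ?_⟩, h1⟩
      · rw [← PNat.coe_le_coe, Nat.succPNat_coe]
        change i.1.2.toNat ≤ n + 1
        omega
      · change i.1.2.toNat ≤ n
        omega
    · intro p hp
      simp only [Finset.mem_sigma, Finset.mem_filter] at hp
      refine mem_halfBox.2 ⟨?_, ?_⟩
      · simpa [halfSpaceShift, axisPoint] using hp.2
      · exact Int.ofNat_le.2 hp.1.2
    · intro i _
      have h3 := i.2
      refine Subtype.ext (Prod.ext ?_ ?_)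
      · simp [halfSpaceShift, axisPoint]
      · simp only [halfSpaceShift, axisPoint]
        change ((i.1.2.toNat : ℕ) : ℤ) = _
        omega
    · rintro ⟨l, x⟩ _
      refine Sigma.ext (PNat.eq ?_) (heq_of_eq ?_)
      · change ((l : ℕ) : ℤ).toNat = _
        simp
      · simp [halfSpaceShift, axisPoint]
    · intro i _
      have h3 := i.2
      congr 1
      refine Subtype.ext (Prod.ext ?_ ?_)
      · simp [halfSpaceShift, axisPoint]
      · simp only [halfSpaceShift, axisPoint]
        change _ = ((i.1.2.toNat : ℕ) : ℤ)
        omega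
  · intro l hl
    rw [if_neg]
    intro hle
    refine hl (Finset.mem_Icc.2 ⟨one_le, ?_⟩)
    rw [← PNat.coe_le_coe, Nat.succPNat_coe]
    omega

end HalfSpace

/-! ### The decaying field -/

section DecayingField

variable {d : ℕ} {J δ : ℝ}

theorem totalField_zero (h : HalfSpace d → ℝ) : totalField 0 h = h := by
  ext i; simp [totalField]

theorem neg_decayingField (s : ℝ) : -decayingField d δ s = decayingField d δ (-s) := by
  ext i; simp [decayingField, neg_div]

/-- The magnetization of the `+` state at height `ℓ`, in the decaying field of strength `s`. -/
def plusMagnetization (d : ℕ) (J δ s : ℝ) (ℓ : ℕ+) : ℝ :=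
  magnetization (semiInfiniteState d J 0 (decayingField d δ s) true) (axisPoint d ℓ)

theorem abs_magnetization_le {V : Type*} [Countable V] (μ : ProbabilityMeasure (Config V))
    (i : V) : |magnetization μ i| ≤ 1 := by
  have := norm_integral_le_of_norm_le_const (μ := (μ : Measure (Config V)))
    (f := fun σ => spin σ i) (C := 1) (ae_of_all _ fun σ => (abs_spin σ i).le)
  simpa [magnetization] using this

theorem tendsto_plusMagnetization (hJ : 0 ≤ J) (s : ℝ) (ℓ : ℕ+) :
    Tendsto (fun Λ => plusMean (halfSpaceGraph d) (fun _ => J) (decayingField d δ s) Λ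
      fun σ => spin σ (axisPoint d ℓ)) atTop (𝓝 (plusMagnetization d J δ s ℓ)) := by
  have := tendsto_plusMean_spin (halfSpaceGraph d) hJ (decayingField d δ s) (axisPoint d ℓ)
  rwa [← totalField_zero (decayingField d δ s)] at this ⊢

/-- The flip turns the `-` magnetization at strength `s` into minus the `+` magnetization at
strength `-s`, so the gap becomes a sum. -/
theorem magnetizationGapTerm_eq (hJ : 0 ≤ J) (s : ℝ) (ℓ : ℕ+) :
    magnetizationGapTerm d J δ s ℓ = 1 / ((ℓ : ℕ) : ℝ) ^ δ * plusMagnetization d J δ s ℓ +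
      1 / ((ℓ : ℕ) : ℝ) ^ δ * plusMagnetization d J δ (-s) ℓ := by
  have : magnetization (semiInfiniteState d J 0 (decayingField d δ s) false) (axisPoint d ℓ) =
      -plusMagnetization d J δ (-s) ℓ := by
    rw [semiInfiniteState, magnetization_minus _ hJ, totalField_zero, neg_decayingField,
      plusMagnetization, semiInfiniteState, totalField_zero]
  rw [magnetizationGapTerm, this, ← plusMagnetization]
  ring

/-- The average of the spins of height `ℓ` in the box `Λ_n`, with boundary condition `+`. -/
def layerMean (d : ℕ) (J δ s : ℝ) (ℓ : ℕ+) (n : ℕ) : ℝ :=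
  (∑ x ∈ baseCube d n, plusMean (halfSpaceGraph d) (fun _ => J) (decayingField d δ s)
    (halfBox d n) fun σ => spin σ (halfSpaceShift x (axisPoint d ℓ))) / (baseCube d n).card

theorem tendsto_layerMean (hJ : 0 ≤ J) (s : ℝ) (ℓ : ℕ+) :
    Tendsto (layerMean d J δ s ℓ) atTop (𝓝 (plusMagnetization d J δ s ℓ)) := by
  have h1 := tendsto_average_spin (halfSpaceGraph d) (K := fun _ => J) (fun _ => hJ)
    (h := decayingField d δ s) (φ := halfSpaceShift) (fun _ _ => rfl) (fun _ _ => rfl)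
    tendsto_halfBox (fun _ _ hkn _ hx => map_halfSpaceShift_subset hkn hx) (axisPoint d ℓ)
  have h2 : Tendsto (fun Λ => plusMean (halfSpaceGraph d) (fun _ => J) (decayingField d δ s) Λ
      fun σ => spin σ (axisPoint d ℓ)) atTop (𝓝 (2 * plusLimit (halfSpaceGraph d) (fun _ => J)
        (decayingField d δ s) (plusInd {axisPoint d ℓ}) - 1)) := by
    simp only [plusMean_spin]
    exact ((tendsto_plusLimit_plusInd _ _ _ (fun _ => hJ) _).const_mul 2).sub_const 1
  -- The layer average has its limit expressed through `plusLimit`; uniqueness of limits identifies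
  -- it with the magnetization of the weak limit.
  rw [tendsto_nhds_unique (tendsto_plusMagnetization hJ s ℓ) h2]
  exact h1

theorem abs_layerMean_le (s : ℝ) (ℓ : ℕ+) (n : ℕ) : |layerMean d J δ s ℓ n| ≤ 1 := by
  rw [layerMean, abs_div, Nat.abs_cast, div_le_one (card_baseCube_pos d n)]
  refine (Finset.abs_sum_le_sum_abs _ _).trans ?_
  have := Finset.sum_le_card_nsmul (baseCube d n)
    (fun x => |plusMean (halfSpaceGraph d) (fun _ => J) (decayingField d δ s) (halfBox d n)
      fun σ => spin σ (halfSpaceShift x (axisPoint d ℓ))|) 1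
    fun x _ => abs_plusMean_le _ _ _ _ fun σ => (abs_spin σ _).le
  simpa using this

theorem summable_inv_rpow (hδ : 1 < δ) : Summable fun ℓ : ℕ+ => 1 / ((ℓ : ℕ) : ℝ) ^ δ :=
  (Real.summable_one_div_nat_rpow.2 hδ).comp_injective PNat.coe_injective

theorem inv_rpow_nonneg (ℓ : ℕ+) : 0 ≤ 1 / ((ℓ : ℕ) : ℝ) ^ δ := by positivity

theorem summable_plusMagnetization (hδ : 1 < δ) (s : ℝ) :
    Summable fun ℓ : ℕ+ => 1 / ((ℓ : ℕ) : ℝ) ^ δ * plusMagnetization d J δ s ℓ := by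
  refine Summable.of_norm_bounded (summable_inv_rpow hδ) fun ℓ => ?_
  rw [norm_mul, Real.norm_of_nonneg (inv_rpow_nonneg ℓ)]
  exact mul_le_of_le_one_right (inv_rpow_nonneg ℓ) (abs_magnetization_le _ _)

/-- The series `∑_ℓ ℓ^{-δ} ⟨σ_{ℓ e_d}⟩⁺` in the decaying field of strength `s`. -/
def plusSeries (d : ℕ) (J δ s : ℝ) : ℝ :=
  ∑' ℓ : ℕ+, 1 / ((ℓ : ℕ) : ℝ) ^ δ * plusMagnetization d J δ s ℓ

/-- The derivative in `s` of the logarithm of the partition function in `Λ_n`, per site of the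
wall. -/
def meanFieldEnergy (d : ℕ) (J δ s : ℝ) (n : ℕ) : ℝ :=
  plusMean (halfSpaceGraph d) (fun _ => J) (decayingField d δ s) (halfBox d n)
    (fun σ => ∑ i ∈ halfBox d n, 1 / (i.1.2 : ℝ) ^ δ * spin σ i) / (baseCube d n).card

theorem plusMean_sum {V ι : Type*} [DecidableEq V] (G : SimpleGraph V) [G.LocallyFinite]
    (K : Sym2 V → ℝ) (h : V → ℝ) (Λ : Finset V) (A : Finset ι) (c : ι → ℝ)
    (f : ι → Config V → ℝ) :
    plusMean G K h Λ (fun σ => ∑ i ∈ A, c i * f i σ) = ∑ i ∈ A, c i * plusMean G K h Λ (f i) := by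
  simp only [plusMean, plusSum, Finset.mul_sum, Finset.sum_div]
  rw [Finset.sum_comm]
  refine Finset.sum_congr rfl fun i _ => Finset.sum_congr rfl fun τ _ => ?_
  ring

theorem meanFieldEnergy_eq (s : ℝ) (n : ℕ) :
    meanFieldEnergy d J δ s n =
      ∑' ℓ : ℕ+, if (ℓ : ℕ) ≤ n then 1 / ((ℓ : ℕ) : ℝ) ^ δ * layerMean d J δ s ℓ n else 0 := by
  rw [meanFieldEnergy, plusMean_sum, sum_halfBox, ← tsum_div_const]
  refine tsum_congr fun ℓ => ?_
  split_ifs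
  · rw [layerMean, ← mul_div_assoc, Finset.mul_sum]
    congr 1
  · simp

theorem norm_meanFieldEnergy_term_le (s : ℝ) (n : ℕ) (ℓ : ℕ+) :
    ‖if (ℓ : ℕ) ≤ n then 1 / ((ℓ : ℕ) : ℝ) ^ δ * layerMean d J δ s ℓ n else 0‖ ≤
      1 / ((ℓ : ℕ) : ℝ) ^ δ := by
  split_ifs
  · rw [norm_mul, Real.norm_of_nonneg (inv_rpow_nonneg ℓ)]
    exact mul_le_of_le_one_right (inv_rpow_nonneg ℓ) (abs_layerMean_le s ℓ n)
  · simpa using inv_rpow_nonneg (δ := δ) ℓ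

/-- Each layer average converges and has modulus at most `1`, so the summable weights `ℓ^{-δ}`
dominate. This is where `δ > 1` enters. -/
theorem tendsto_meanFieldEnergy (hJ : 0 ≤ J) (hδ : 1 < δ) (s : ℝ) :
    Tendsto (meanFieldEnergy d J δ s) atTop (𝓝 (plusSeries d J δ s)) := by
  simp only [funext (meanFieldEnergy_eq (d := d) (J := J) (δ := δ) s), plusSeries]
  refine tendsto_tsum_of_dominated_convergence (summable_inv_rpow hδ) (fun ℓ => ?_)
    (Eventually.of_forall fun n ℓ => norm_meanFieldEnergy_term_le s n ℓ)
  refine ((tendsto_layerMean hJ s ℓ).const_mul _).congr' ?_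
  filter_upwards [eventually_ge_atTop (ℓ : ℕ)] with n hn
  rw [if_pos hn]

theorem norm_meanFieldEnergy_le (hδ : 1 < δ) (s : ℝ) (n : ℕ) :
    ‖meanFieldEnergy d J δ s n‖ ≤ ∑' ℓ : ℕ+, 1 / ((ℓ : ℕ) : ℝ) ^ δ := by
  rw [meanFieldEnergy_eq]
  exact tsum_of_norm_bounded (summable_inv_rpow hδ).hasSum
    fun ℓ => norm_meanFieldEnergy_term_le s n ℓ

/-! ### Integration over the field strength -/

theorem exponent_add_mul_field {V : Type*} [DecidableEq V] (G : SimpleGraph V) [G.LocallyFinite]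
    (K : Sym2 V → ℝ) (h g : V → ℝ) (s : ℝ) (Λ : Finset V) (σ : Config V) :
    exponent G K (fun i => h i + s * g i) Λ σ =
      exponent G K h Λ σ + s * ∑ i ∈ Λ, g i * spin σ i := by
  simp only [exponent, Finset.mul_sum, add_mul, Finset.sum_add_distrib, mul_assoc, add_assoc]

theorem exponent_decayingField (s : ℝ) (Λ : Finset (HalfSpace d)) (σ : Config (HalfSpace d)) :
    exponent (halfSpaceGraph d) (fun _ => J) (decayingField d δ s) Λ σ =
      exponent (halfSpaceGraph d) (fun _ => J) 0 Λ σ +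
        s * ∑ i ∈ Λ, 1 / (i.1.2 : ℝ) ^ δ * spin σ i := by
  rw [← exponent_add_mul_field]
  congr 1
  ext i
  simp [decayingField, div_eq_mul_inv]

theorem meanFieldEnergy_eq_div (s : ℝ) (n : ℕ) : meanFieldEnergy d J δ s n =
    (∑ τ : halfBox d n → Bool, Real.exp (exponent (halfSpaceGraph d) (fun _ => J) 0
      (halfBox d n) (glue (halfBox d n) (constBC _ true) τ) +
      s * ∑ i ∈ halfBox d n, 1 / (i.1.2 : ℝ) ^ δ *
        spin (glue (halfBox d n) (constBC _ true) τ) i) *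
      ∑ i ∈ halfBox d n, 1 / (i.1.2 : ℝ) ^ δ * spin (glue (halfBox d n) (constBC _ true) τ) i) /
    (∑ τ : halfBox d n → Bool, Real.exp (exponent (halfSpaceGraph d) (fun _ => J) 0
      (halfBox d n) (glue (halfBox d n) (constBC _ true) τ) +
      s * ∑ i ∈ halfBox d n, 1 / (i.1.2 : ℝ) ^ δ *
        spin (glue (halfBox d n) (constBC _ true) τ) i)) / (baseCube d n).card := by
  simp only [meanFieldEnergy, plusMean, plusSum, exponent_decayingField, Pi.one_apply, mul_one]

theorem continuous_meanFieldEnergy (n : ℕ) : Continuous fun s => meanFieldEnergy d J δ s n := by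
  simp only [meanFieldEnergy_eq_div]
  exact (continuous_mean_exp _ _).div_const _

theorem log_plusSum_decayingField (r : ℝ) (n : ℕ) :
    (Real.log (plusSum (halfSpaceGraph d) (fun _ => J) (decayingField d δ r) (halfBox d n) 1) -
      Real.log (plusSum (halfSpaceGraph d) (fun _ => J) 0 (halfBox d n) 1)) /
        (baseCube d n).card = ∫ s in (0 : ℝ)..r, meanFieldEnergy d J δ s n := by
  simp only [meanFieldEnergy_eq_div]
  rw [intervalIntegral.integral_div, ← log_sum_exp_sub]
  simp only [plusSum, exponent_decayingField, Pi.one_apply, mul_one]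

/-- Measurability and boundedness in `s` pass to the pointwise limit from the finite-volume
energies, which are continuous and uniformly bounded. -/
theorem intervalIntegrable_plusSeries (hJ : 0 ≤ J) (hδ : 1 < δ) (a b : ℝ) :
    IntervalIntegrable (plusSeries d J δ) volume a b := by
  have hmeas : Measurable (plusSeries d J δ) :=
    measurable_of_tendsto_metrizable (fun n => (continuous_meanFieldEnergy n).measurable)
      (tendsto_pi_nhds.2 fun s => tendsto_meanFieldEnergy hJ hδ s)
  refine (intervalIntegrable_const (c := ∑' ℓ : ℕ+, 1 / ((ℓ : ℕ) : ℝ) ^ δ)).mono_fun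
    hmeas.aestronglyMeasurable (ae_of_all _ fun s => ?_)
  exact (le_of_tendsto (tendsto_meanFieldEnergy hJ hδ s).norm
    (Eventually.of_forall fun n => norm_meanFieldEnergy_le hδ s n)).trans (Real.le_norm_self _)

theorem tendsto_log_plusSum_decayingField (hJ : 0 ≤ J) (hδ : 1 < δ) (r : ℝ) :
    Tendsto (fun n =>
      (Real.log (plusSum (halfSpaceGraph d) (fun _ => J) (decayingField d δ r) (halfBox d n) 1) -
        Real.log (plusSum (halfSpaceGraph d) (fun _ => J) 0 (halfBox d n) 1)) /
          (baseCube d n).card) atTop (𝓝 (∫ s in (0 : ℝ)..r, plusSeries d J δ s)) := by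
  simp only [log_plusSum_decayingField]
  exact intervalIntegral.tendsto_integral_filter_of_dominated_convergence
    (fun _ => ∑' ℓ : ℕ+, 1 / ((ℓ : ℕ) : ℝ) ^ δ)
    (Eventually.of_forall fun n => (continuous_meanFieldEnergy n).aestronglyMeasurable)
    (Eventually.of_forall fun n => ae_of_all _ fun s _ => norm_meanFieldEnergy_le hδ s n)
    intervalIntegrable_const (ae_of_all _ fun s _ => tendsto_meanFieldEnergy hJ hδ s)

end DecayingField

/-! ### The zero-field model in the extended box -/

section ZeroField

variable {d : ℕ} {J : ℝ}

theorem mem_extendedBox {n : ℕ} {i : Site d} :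
    i ∈ extendedBox d n ↔ i.1 ∈ baseCube d n ∧ 1 - (n : ℤ) ≤ i.2 ∧ i.2 ≤ n := by
  simp only [extendedBox, box, Finset.mem_union, Finset.mem_product, Finset.mem_Icc,
    Finset.mem_image, reflect]
  constructor
  · rintro (⟨h1, h2, h3⟩ | ⟨j, ⟨h1, h2, h3⟩, rfl⟩)
    · exact ⟨h1, by omega, h3⟩
    · exact ⟨h1, by simp only; omega, by simp only; omega⟩
  · rintro ⟨h1, h2, h3⟩
    by_cases h : 1 ≤ i.2
    · exact .inl ⟨h1, h, h3⟩
    · exact .inr ⟨(i.1, 1 - i.2), ⟨h1, by simp only; omega, by simp only; omega⟩,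
        Prod.ext rfl (by simp)⟩

theorem tendsto_extendedBox : Tendsto (extendedBox d) atTop atTop := by
  refine tendsto_atTop_finset_of_monotone (fun m n hmn i hi => ?_) fun i => ?_
  · rw [mem_extendedBox] at *
    exact ⟨baseCube_mono d hmn hi.1, by omega, by omega⟩
  · obtain ⟨n, hn⟩ := exists_mem_baseCube i.1
    refine ⟨n + (i.2.natAbs + 1), mem_extendedBox.2 ⟨baseCube_mono d (by omega) hn, ?_, ?_⟩⟩ <;>
      omega

theorem map_latticeShift_subset {k n : ℕ} (hkn : k ≤ n) {x : Fin (d - 1) → ℤ}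
    (hx : x ∈ baseCube d (n - k)) :
    (extendedBox d k).map (latticeShift x).toEquiv.toEmbedding ⊆ extendedBox d n := by
  intro i hi
  obtain ⟨j, hj, rfl⟩ := Finset.mem_map.1 hi
  rw [mem_extendedBox] at hj ⊢
  refine ⟨add_mem_baseCube hkn hx hj.1, ?_⟩
  change 1 - (n : ℤ) ≤ j.2 ∧ j.2 ≤ n
  omega

/-- The couplings equal to `t J` on the bonds that cross the hyperplane `i_d = 1 / 2` and to `J`
on all others. -/
def crossingCoupling (d : ℕ) (J t : ℝ) : Sym2 (Site d) → ℝ :=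
  Sym2.lift ⟨fun i j => if 1 ≤ i.2 ↔ 1 ≤ j.2 then J else t * J, fun i j => by
    simp only [iff_comm]⟩

theorem crossingCoupling_mk (t : ℝ) (i j : Site d) :
    crossingCoupling d J t s(i, j) = if 1 ≤ i.2 ↔ 1 ≤ j.2 then J else t * J := rfl

theorem crossingCoupling_one : crossingCoupling d J 1 = fun _ => J := by
  ext e
  induction e with | _ i j
  simp [crossingCoupling_mk]

theorem crossingCoupling_nonneg (hJ : 0 ≤ J) {t : ℝ} (ht : 0 ≤ t) (e : Sym2 (Site d)) :
    0 ≤ crossingCoupling d J t e := by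
  induction e with | _ i j
  rw [crossingCoupling_mk]
  split_ifs
  · exact hJ
  · exact mul_nonneg ht hJ

theorem crossingCoupling_shift (t : ℝ) (x : Fin (d - 1) → ℤ) (e : Sym2 (Site d)) :
    crossingCoupling d J t (e.map (latticeShift x)) = crossingCoupling d J t e := by
  induction e with | _ i j
  rfl

theorem eq_of_adj_of_crossing {i j : Site d} (h : (latticeGraph d).Adj i j) (hi : 1 ≤ i.2)
    (hj : ¬1 ≤ j.2) : i = (i.1, 1) ∧ j = (i.1, 0) := by
  have h' : ∑ k, |i.1 k - j.1 k| + |i.2 - j.2| = 1 := h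
  have h0 : 0 ≤ ∑ k, |i.1 k - j.1 k| := Finset.sum_nonneg fun k _ => abs_nonneg _
  have h1 : |i.2 - j.2| = i.2 - j.2 := abs_of_nonneg (by omega)
  have h2 : ∑ k, |i.1 k - j.1 k| = 0 := by omega
  rw [Finset.sum_eq_zero_iff_of_nonneg fun k _ => abs_nonneg _] at h2
  refine ⟨Prod.ext rfl (by simp only; omega), Prod.ext (funext fun k => ?_) (by simp only; omega)⟩
  have := abs_eq_zero.1 (h2 k (Finset.mem_univ k))
  simp only
  omega

/-- The crossing bonds that meet the box are the vertical ones over the base cube. For `n = 0` this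
fails: the box is empty while the base cube is a point. -/
theorem sum_crossing {n : ℕ} (hn : 1 ≤ n) (t : ℝ) (σ : Config (Site d)) :
    ∑ e ∈ bondsMeeting (latticeGraph d) (extendedBox d n), crossingCoupling d J t e * bondSpin σ e =
      ∑ e ∈ bondsMeeting (latticeGraph d) (extendedBox d n),
        crossingCoupling d J 0 e * bondSpin σ e +
      t * ∑ x ∈ baseCube d n, J * (spin σ (x, 1) * spin σ (x, 0)) := by
  rw [← sub_eq_iff_eq_add', ← Finset.sum_sub_distrib, Finset.mul_sum]
  symm
  refine Finset.sum_of_injOn (fun x => s((x, 1), (x, 0))) ?_ ?_ ?_ ?_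
  · intro x _ y _ hxy
    simpa using hxy
  · intro x hx
    refine (mem_bondsMeeting _ _ _).2 ⟨?_, (x, 1), mem_extendedBox.2 ⟨hx, ?_⟩, by simp⟩
    · simp [latticeGraph]
    · simp only; omega
  · intro e he hex
    obtain ⟨he1, a, ha, hae⟩ := (mem_bondsMeeting _ _ _).1 he
    have ha' := (mem_extendedBox.1 ha).1
    induction e with | _ i j
    have hadj : (latticeGraph d).Adj i j := he1
    rw [crossingCoupling_mk, crossingCoupling_mk]
    by_cases hi : 1 ≤ i.2 <;> by_cases hj : 1 ≤ j.2
    · simp [hi, hj]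
    · obtain ⟨h1, h2⟩ := eq_of_adj_of_crossing hadj hi hj
      refine absurd ⟨i.1, ?_, ?_⟩ hex
      · rcases Sym2.mem_iff.1 hae with rfl | rfl
        · exact ha'
        · rw [h2] at ha'; exact ha'
      · simp only
        rw [← h1, ← h2]
    · obtain ⟨h1, h2⟩ := eq_of_adj_of_crossing hadj.symm hj hi
      refine absurd ⟨j.1, ?_, ?_⟩ hex
      · rcases Sym2.mem_iff.1 hae with rfl | rfl
        · rw [h2] at ha'; exact ha'
        · exact ha'
      · simp only
        rw [← h1, ← h2, Sym2.eq_swap]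
    · simp [hi, hj]
  · intro x _
    simp [crossingCoupling_mk, bondSpin]
    ring

theorem exponent_crossingCoupling {n : ℕ} (hn : 1 ≤ n) (t : ℝ) (σ : Config (Site d)) :
    exponent (latticeGraph d) (crossingCoupling d J t) 0 (extendedBox d n) σ =
      exponent (latticeGraph d) (crossingCoupling d J 0) 0 (extendedBox d n) σ +
        t * ∑ x ∈ baseCube d n, J * (spin σ (x, 1) * spin σ (x, 0)) := by
  simp only [exponent, Pi.zero_apply, zero_mul, Finset.sum_const_zero, add_zero]
  exact sum_crossing hn t σ

/-- The mean energy of the bonds that cross the hyperplane `i_d = 1 / 2`, per site of the wall. -/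
def crossingEnergy (d : ℕ) (J t : ℝ) (n : ℕ) : ℝ :=
  plusMean (latticeGraph d) (crossingCoupling d J t) 0 (extendedBox d n)
    (fun σ => ∑ x ∈ baseCube d n, J * (spin σ (x, 1) * spin σ (x, 0))) / (baseCube d n).card

theorem crossingEnergy_eq (t : ℝ) (n : ℕ) : crossingEnergy d J t n =
    J * ((∑ x ∈ baseCube d n, plusMean (latticeGraph d) (crossingCoupling d J t) 0
      (extendedBox d n) fun σ => spin σ (x, 1) * spin σ (x, 0)) / (baseCube d n).card) := by
  rw [crossingEnergy,
    plusMean_sum _ _ _ _ _ (fun _ => J) fun x σ => spin σ (x, 1) * spin σ (x, 0),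
    ← Finset.mul_sum, mul_div_assoc]

/-- The modified couplings are still invariant under shifts along the wall, and `0 ≤ t` keeps them
ferromagnetic, so the averaging argument applies. -/
theorem exists_tendsto_crossingEnergy (hJ : 0 ≤ J) {t : ℝ} (ht : 0 ≤ t) :
    ∃ L, Tendsto (crossingEnergy d J t) atTop (𝓝 L) := by
  have := tendsto_average_spin_mul_spin (latticeGraph d)
    (crossingCoupling_nonneg (d := d) hJ ht) (h := 0) (φ := latticeShift)
    (crossingCoupling_shift t) (fun _ _ => rfl) tendsto_extendedBox
    (fun _ _ hkn _ hx => map_latticeShift_subset hkn hx) (0, 1) (0, 0)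
  refine ⟨_, (this.const_mul J).congr fun n => ?_⟩
  have hs : ∀ (x : Fin (d - 1) → ℤ) (a : ℤ), latticeShift x (0, a) = (x, a) :=
    fun x a => Prod.ext (zero_add x) rfl
  rw [crossingEnergy_eq]
  simp only [hs]

theorem norm_crossingEnergy_le (hJ : 0 ≤ J) (t : ℝ) (n : ℕ) : ‖crossingEnergy d J t n‖ ≤ J := by
  have hc := card_baseCube_pos d n
  rw [crossingEnergy, Real.norm_eq_abs, abs_div, Nat.abs_cast, div_le_iff₀ hc]
  refine abs_plusMean_le _ _ _ _ fun σ => (Finset.abs_sum_le_sum_abs _ _).trans ?_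
  simp [abs_mul, abs_spin, abs_of_nonneg hJ, mul_comm]

theorem crossingEnergy_eq_div {n : ℕ} (hn : 1 ≤ n) (t : ℝ) : crossingEnergy d J t n =
    (∑ τ : extendedBox d n → Bool, Real.exp (exponent (latticeGraph d) (crossingCoupling d J 0) 0
      (extendedBox d n) (glue (extendedBox d n) (constBC _ true) τ) +
      t * ∑ x ∈ baseCube d n, J * (spin (glue (extendedBox d n) (constBC _ true) τ) (x, 1) *
        spin (glue (extendedBox d n) (constBC _ true) τ) (x, 0))) *
      ∑ x ∈ baseCube d n, J * (spin (glue (extendedBox d n) (constBC _ true) τ) (x, 1) *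
        spin (glue (extendedBox d n) (constBC _ true) τ) (x, 0))) /
    (∑ τ : extendedBox d n → Bool, Real.exp (exponent (latticeGraph d) (crossingCoupling d J 0) 0
      (extendedBox d n) (glue (extendedBox d n) (constBC _ true) τ) +
      t * ∑ x ∈ baseCube d n, J * (spin (glue (extendedBox d n) (constBC _ true) τ) (x, 1) *
        spin (glue (extendedBox d n) (constBC _ true) τ) (x, 0)))) / (baseCube d n).card := by
  simp only [crossingEnergy, plusMean, plusSum, exponent_crossingCoupling hn t, Pi.one_apply,
    mul_one]

theorem continuous_crossingEnergy {n : ℕ} (hn : 1 ≤ n) :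
    Continuous fun t => crossingEnergy d J t n := by
  simp only [crossingEnergy_eq_div hn]
  exact (continuous_mean_exp _ _).div_const _

theorem log_plusSum_crossingCoupling {n : ℕ} (hn : 1 ≤ n) :
    (Real.log (plusSum (latticeGraph d) (fun _ => J) 0 (extendedBox d n) 1) -
      Real.log (plusSum (latticeGraph d) (crossingCoupling d J 0) 0 (extendedBox d n) 1)) /
        (baseCube d n).card = ∫ t in (0 : ℝ)..1, crossingEnergy d J t n := by
  simp only [crossingEnergy_eq_div hn]
  rw [intervalIntegral.integral_div, ← log_sum_exp_sub, ← crossingCoupling_one]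
  simp only [plusSum, exponent_crossingCoupling hn 1, Pi.one_apply, mul_one]

theorem exists_tendsto_log_plusSum_crossingCoupling (hJ : 0 ≤ J) :
    ∃ L, Tendsto (fun n =>
      (Real.log (plusSum (latticeGraph d) (fun _ => J) 0 (extendedBox d n) 1) -
        Real.log (plusSum (latticeGraph d) (crossingCoupling d J 0) 0 (extendedBox d n) 1)) /
          (baseCube d n).card) atTop (𝓝 L) := by
  -- The integrand must be a function on all of `ℝ`; its values at negative `t` are arbitrary and
  -- lie outside the integration range.
  have hlim : ∀ t : ℝ, ∃ L, 0 ≤ t → Tendsto (crossingEnergy d J t) atTop (𝓝 L) := fun t => by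
    by_cases ht : 0 ≤ t
    · obtain ⟨L, hL⟩ := exists_tendsto_crossingEnergy (d := d) hJ ht
      exact ⟨L, fun _ => hL⟩
    · exact ⟨0, fun h => absurd h ht⟩
  choose L hL using hlim
  refine ⟨∫ t in (0 : ℝ)..1, L t, Tendsto.congr' (f₁ := fun n =>
    ∫ t in (0 : ℝ)..1, crossingEnergy d J t n) ?_ ?_⟩
  · filter_upwards [eventually_ge_atTop 1] with n hn
    exact (log_plusSum_crossingCoupling hn).symm
  · refine intervalIntegral.tendsto_integral_filter_of_dominated_convergence (fun _ => J)
      ?_ (Eventually.of_forall fun n => ae_of_all _ fun t _ => norm_crossingEnergy_le hJ t n)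
      intervalIntegrable_const (ae_of_all _ fun t ht => hL t ?_)
    · filter_upwards [eventually_ge_atTop 1] with n hn
      exact (continuous_crossingEnergy hn).aestronglyMeasurable
    · rw [Set.uIoc_of_le zero_le_one] at ht
      exact ht.1.le

/-! ### Factorization over the two half-spaces -/

/-- The inclusion of the half-space in the lattice. -/
def upper : HalfSpace d ↪ Site d := Function.Embedding.subtype _

/-- The inclusion of the half-space in the lattice, followed by the reflection. -/
def lower : HalfSpace d ↪ Site d where
  toFun i := reflect i.1
  inj' i j hij := by
    simp only [reflect, Prod.mk.injEq, sub_right_inj] at hij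
    exact Subtype.ext (Prod.ext hij.1 hij.2)

theorem reflect_reflect (i : Site d) : reflect (reflect i) = i := Prod.ext rfl (by simp [reflect])

theorem latticeGraph_adj_reflect (i j : Site d) :
    (latticeGraph d).Adj (reflect i) (reflect j) ↔ (latticeGraph d).Adj i j := by
  simp only [latticeGraph, reflect, sub_sub_sub_cancel_left, abs_sub_comm]

theorem one_le_reflect {i : Site d} (hi : ¬1 ≤ i.2) : 1 ≤ (reflect i).2 := by
  simp only [reflect]; omega

theorem upper_mem_extendedBox {n : ℕ} {i : HalfSpace d} :
    upper i ∈ extendedBox d n ↔ i ∈ halfBox d n := by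
  have := i.2
  rw [mem_extendedBox, mem_halfBox]
  refine and_congr_right fun _ => ?_
  change 1 - (n : ℤ) ≤ i.1.2 ∧ i.1.2 ≤ n ↔ _
  omega

theorem lower_mem_extendedBox {n : ℕ} {i : HalfSpace d} :
    lower i ∈ extendedBox d n ↔ i ∈ halfBox d n := by
  have := i.2
  rw [mem_extendedBox, mem_halfBox]
  refine and_congr_right fun _ => ?_
  change 1 - (n : ℤ) ≤ 1 - i.1.2 ∧ 1 - i.1.2 ≤ n ↔ _
  omega

theorem upper_or_lower (i : Site d) : (∃ j, upper j = i) ∨ ∃ j, lower j = i := by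
  by_cases hi : 1 ≤ i.2
  · exact .inl ⟨⟨i, hi⟩, rfl⟩
  · exact .inr ⟨⟨reflect i, one_le_reflect hi⟩, reflect_reflect i⟩

theorem one_le_upper (i : HalfSpace d) : 1 ≤ (upper i).2 := i.2

theorem not_one_le_lower (i : HalfSpace d) : ¬1 ≤ (lower i).2 := by
  have := i.2
  change ¬1 ≤ 1 - i.1.2
  omega

theorem map_bondsMeeting_subset {n : ℕ} {ι : HalfSpace d ↪ Site d}
    (hadj : ∀ i j, (latticeGraph d).Adj (ι i) (ι j) ↔ (halfSpaceGraph d).Adj i j)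
    (hmem : ∀ i, ι i ∈ extendedBox d n ↔ i ∈ halfBox d n) :
    (bondsMeeting (halfSpaceGraph d) (halfBox d n)).map ι.sym2Map ⊆
      bondsMeeting (latticeGraph d) (extendedBox d n) := by
  intro e' he'
  obtain ⟨e, he, rfl⟩ := Finset.mem_map.1 he'
  rw [mem_bondsMeeting] at he ⊢
  obtain ⟨he1, i, hi, hie⟩ := he
  rw [Function.Embedding.sym2Map_apply]
  refine ⟨?_, ι i, (hmem i).2 hi, Sym2.mem_map.2 ⟨i, hie, rfl⟩⟩
  induction e with | _ a b
  rw [SimpleGraph.mem_edgeSet] at he1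
  rw [Sym2.map_mk, SimpleGraph.mem_edgeSet]
  exact (hadj a b).2 he1

theorem mem_map_bondsMeeting {n : ℕ} {ι : HalfSpace d ↪ Site d}
    (hadj : ∀ i j, (latticeGraph d).Adj (ι i) (ι j) ↔ (halfSpaceGraph d).Adj i j)
    (hmem : ∀ i, ι i ∈ extendedBox d n ↔ i ∈ halfBox d n) {i j : HalfSpace d}
    (h : s(ι i, ι j) ∈ bondsMeeting (latticeGraph d) (extendedBox d n)) :
    s(ι i, ι j) ∈ (bondsMeeting (halfSpaceGraph d) (halfBox d n)).map ι.sym2Map := by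
  obtain ⟨h1, a, ha, hae⟩ := (mem_bondsMeeting _ _ _).1 h
  refine Finset.mem_map.2 ⟨s(i, j), (mem_bondsMeeting _ _ _).2 ⟨(hadj i j).1 h1, ?_⟩, rfl⟩
  rcases Sym2.mem_iff.1 hae with rfl | rfl
  · exact ⟨i, (hmem i).1 ha, by simp⟩
  · exact ⟨j, (hmem j).1 ha, by simp⟩

/-- With crossing couplings zero, each remaining bond lies in one half-space, and the reflection
carries the lower half onto the upper one. -/
theorem exponent_uncoupled (n : ℕ) (σ : Config (Site d)) :
    exponent (latticeGraph d) (crossingCoupling d J 0) 0 (extendedBox d n) σ =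
      exponent (halfSpaceGraph d) (fun _ => J) 0 (halfBox d n) (σ ∘ upper) +
        exponent (halfSpaceGraph d) (fun _ => J) 0 (halfBox d n) (σ ∘ lower) := by
  have hu : ∀ i j : HalfSpace d, (latticeGraph d).Adj (upper i) (upper j) ↔
      (halfSpaceGraph d).Adj i j := fun i j => Iff.rfl
  have hl : ∀ i j : HalfSpace d, (latticeGraph d).Adj (lower i) (lower j) ↔
      (halfSpaceGraph d).Adj i j := fun i j => latticeGraph_adj_reflect _ _
  simp only [exponent, Pi.zero_apply, zero_mul, Finset.sum_const_zero, add_zero]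
  have hsub := Finset.union_subset
    (map_bondsMeeting_subset (n := n) hu fun i => upper_mem_extendedBox)
    (map_bondsMeeting_subset (n := n) hl fun i => lower_mem_extendedBox)
  rw [← Finset.sum_subset hsub, Finset.sum_union, Finset.sum_map, Finset.sum_map]
  · congr 1 <;> refine Finset.sum_congr rfl fun e _ => ?_
    · change crossingCoupling d J 0 (e.map upper) * bondSpin σ (e.map upper) = _
      rw [bondSpin_map]
      induction e with | _ i j
      simp [crossingCoupling_mk, one_le_upper]
    · change crossingCoupling d J 0 (e.map lower) * bondSpin σ (e.map lower) = _
      rw [bondSpin_map]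
      induction e with | _ i j
      simp [crossingCoupling_mk, not_one_le_lower]
  · rw [Finset.disjoint_left]
    rintro e h1 h2
    obtain ⟨e1, -, rfl⟩ := Finset.mem_map.1 h1
    obtain ⟨e2, -, h⟩ := Finset.mem_map.1 h2
    induction e1 with | _ i j
    have hi : upper i ∈ e2.map lower := by
      change e2.map lower = s(upper i, upper j) at h
      simp [h]
    obtain ⟨k, -, hk⟩ := Sym2.mem_map.1 hi
    exact not_one_le_lower k (hk ▸ one_le_upper i)
  · intro e he hne
    induction e with | _ i j
    rcases upper_or_lower i with ⟨i, rfl⟩ | ⟨i, rfl⟩ <;>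
      rcases upper_or_lower j with ⟨j, rfl⟩ | ⟨j, rfl⟩
    · exact absurd (Finset.mem_union_left _
        (mem_map_bondsMeeting hu (fun i => upper_mem_extendedBox) he)) hne
    · simp [crossingCoupling_mk, one_le_upper, not_one_le_lower]
    · simp [crossingCoupling_mk, one_le_upper, not_one_le_lower]
    · exact absurd (Finset.mem_union_right _
        (mem_map_bondsMeeting hl (fun i => lower_mem_extendedBox) he)) hne

/-- The configuration with restrictions `σ` and `σ'` (reflected) to the two half-spaces. -/
def joinConfig (σ σ' : Config (HalfSpace d)) : Config (Site d) := fun i =>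
  if hi : 1 ≤ i.2 then σ ⟨i, hi⟩ else σ' ⟨reflect i, one_le_reflect hi⟩

theorem joinConfig_upper (σ σ' : Config (HalfSpace d)) : joinConfig σ σ' ∘ upper = σ := by
  ext i
  exact dif_pos i.2

theorem joinConfig_lower (σ σ' : Config (HalfSpace d)) : joinConfig σ σ' ∘ lower = σ' := by
  ext i
  refine (dif_neg (not_one_le_lower i)).trans (congrArg σ' (Subtype.ext ?_))
  exact reflect_reflect i.1

theorem config_ext {σ σ' : Config (Site d)} (hu : σ ∘ upper = σ' ∘ upper)
    (hl : σ ∘ lower = σ' ∘ lower) : σ = σ' := by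
  ext i
  rcases upper_or_lower i with ⟨i, rfl⟩ | ⟨i, rfl⟩
  · exact congrFun hu i
  · exact congrFun hl i

theorem plusSum_uncoupled (n : ℕ) :
    plusSum (latticeGraph d) (crossingCoupling d J 0) 0 (extendedBox d n) 1 =
      plusSum (halfSpaceGraph d) (fun _ => J) 0 (halfBox d n) 1 ^ 2 := by
  have key : ∀ ι : HalfSpace d ↪ Site d, (∀ i, ι i ∈ extendedBox d n ↔ i ∈ halfBox d n) →
      ∀ τ : extendedBox d n → Bool, glue (halfBox d n) (constBC _ true)
        (fun i => (glue (extendedBox d n) (constBC _ true) τ ∘ ι) i) =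
          glue (extendedBox d n) (constBC _ true) τ ∘ ι := by
    intro ι hι τ
    refine glue_restrict fun i hi => ?_
    exact glue_of_notMem (fun h => hi ((hι i).1 h)) _ _
  have hout : ∀ τ τ' : halfBox d n → Bool, ∀ i ∉ extendedBox d n,
      joinConfig (glue (halfBox d n) (constBC _ true) τ) (glue (halfBox d n) (constBC _ true) τ') i
        = constBC _ true i := by
    intro τ τ' i hi
    rcases upper_or_lower i with ⟨i, rfl⟩ | ⟨i, rfl⟩
    · refine (congrFun (joinConfig_upper _ _) i).trans (glue_of_notMem ?_ _ _)
      rwa [upper_mem_extendedBox] at hi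
    · refine (congrFun (joinConfig_lower _ _) i).trans (glue_of_notMem ?_ _ _)
      rwa [lower_mem_extendedBox] at hi
  rw [sq, plusSum, plusSum, Finset.sum_mul_sum, ← Finset.sum_product']
  -- A configuration in the doubled box is the same as a pair in the half box, by restriction to the
  -- two halves and by joining.
  refine Finset.sum_bij'
    (fun τ _ => (fun i => (glue (extendedBox d n) (constBC _ true) τ ∘ upper) i,
      fun i => (glue (extendedBox d n) (constBC _ true) τ ∘ lower) i))
    (fun p _ i => joinConfig (glue (halfBox d n) (constBC _ true) p.1)
      (glue (halfBox d n) (constBC _ true) p.2) i) (by simp) (by simp) ?_ ?_ ?_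
  · intro τ _
    simp only [key upper fun i => upper_mem_extendedBox,
      key lower fun i => lower_mem_extendedBox]
    rw [← restrict_glue (extendedBox d n) (constBC _ true) τ]
    rw [config_ext (joinConfig_upper _ _) (joinConfig_lower _ _), restrict_glue]
  · intro p _
    simp only [glue_restrict (hout p.1 p.2), joinConfig_upper, joinConfig_lower, restrict_glue]
  · intro τ _
    simp only [key upper fun i => upper_mem_extendedBox,
      key lower fun i => lower_mem_extendedBox, Pi.one_apply, mul_one, ← Real.exp_add,
      exponent_uncoupled]

end ZeroField

/-! ### The surface free energies -/

section SurfaceFreeEnergy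

variable {d : ℕ} {J δ : ℝ}

theorem card_wallBox (n : ℕ) : (wallBox d n).card = (baseCube d n).card := by
  simp [wallBox]

/-- Inserts the reference value `z₀`, later the zero-field half-space partition function, to
separate the field from the bulk comparison. -/
theorem log_sq_div_div {W z z₀ q : ℝ} (hz : 0 < z) (hq : 0 < q) :
    -(1 / (2 * W)) * Real.log (z ^ 2 / q) =
      1 / 2 * ((Real.log q - Real.log (z₀ ^ 2)) / W) -
        (Real.log z - Real.log z₀) / W := by
  rw [Real.log_div (by positivity) hq.ne', Real.log_pow, Real.log_pow]
  push_cast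
  ring

/-- The first summand does not depend on `b`: with no field the flip identifies the two bulk
partition functions. -/
theorem surfaceFreeEnergySeq_eq (lam : ℝ) (b : Bool) (n : ℕ) :
    surfaceFreeEnergySeq d J 0 (decayingField d δ lam) b n =
      1 / 2 * ((Real.log (plusSum (latticeGraph d) (fun _ => J) 0 (extendedBox d n) 1) -
        Real.log (plusSum (latticeGraph d) (crossingCoupling d J 0) 0 (extendedBox d n) 1)) /
          (baseCube d n).card) -
      (Real.log (plusSum (halfSpaceGraph d) (fun _ => J)
        (decayingField d δ (if b then lam else -lam)) (halfBox d n) 1) -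
        Real.log (plusSum (halfSpaceGraph d) (fun _ => J) 0 (halfBox d n) 1)) /
          (baseCube d n).card := by
  rw [surfaceFreeEnergySeq, card_wallBox, totalField_zero, plusSum_uncoupled]
  cases b
  · rw [partitionFunction_minus, partitionFunction_minus, neg_zero, neg_decayingField,
      partitionFunction_plus, partitionFunction_plus]
    exact log_sq_div_div (plusSum_one_pos _ _ _ _) (plusSum_one_pos _ _ _ _)
  · rw [partitionFunction_plus, partitionFunction_plus]
    exact log_sq_div_div (plusSum_one_pos _ _ _ _) (plusSum_one_pos _ _ _ _)

theorem exists_tendsto_surfaceFreeEnergySeq (hJ : 0 ≤ J) (hδ : 1 < δ) (lam : ℝ) :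
    ∃ F₀ : ℝ, ∀ b : Bool,
      Tendsto (surfaceFreeEnergySeq d J 0 (decayingField d δ lam) b) atTop
        (𝓝 (F₀ - ∫ s in (0 : ℝ)..if b then lam else -lam, plusSeries d J δ s)) := by
  obtain ⟨L, hL⟩ := exists_tendsto_log_plusSum_crossingCoupling (d := d) hJ
  refine ⟨1 / 2 * L, fun b => ?_⟩
  simp only [funext (surfaceFreeEnergySeq_eq (d := d) (J := J) (δ := δ) lam b)]
  exact (hL.const_mul _).sub (tendsto_log_plusSum_decayingField hJ hδ _)

theorem summable_magnetizationGapTerm (hJ : 0 ≤ J) (hδ : 1 < δ) (s : ℝ) :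
    Summable (magnetizationGapTerm d J δ s) := by
  simp only [funext (magnetizationGapTerm_eq (d := d) (δ := δ) hJ s)]
  exact (summable_plusMagnetization hδ s).add (summable_plusMagnetization hδ (-s))

theorem tsum_magnetizationGapTerm (hJ : 0 ≤ J) (hδ : 1 < δ) (s : ℝ) :
    ∑' ℓ : ℕ+, magnetizationGapTerm d J δ s ℓ = plusSeries d J δ s + plusSeries d J δ (-s) := by
  simp only [magnetizationGapTerm_eq (d := d) (δ := δ) hJ s]
  exact (summable_plusMagnetization hδ s).tsum_add (summable_plusMagnetization hδ (-s))

end SurfaceFreeEnergy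

end SemiInfiniteIsing

end

theorem mainTheorem6 (d : ℕ) (hd : 2 ≤ d) (J δ lam : ℝ) (hJ : 0 < J) (hδ : 1 < δ)
    (hlam : 0 ≤ lam) :
    -- the infinite-volume `+` and `-` states exist as weak limits along the finite sets
    (∀ s ∈ Set.Icc 0 lam, ∀ b : Bool,
      Tendsto
        (SemiInfiniteIsing.semiInfiniteGibbs d J 0 (SemiInfiniteIsing.decayingField d δ s) b)
        atTop
        (𝓝 (SemiInfiniteIsing.semiInfiniteState d J 0
          (SemiInfiniteIsing.decayingField d δ s) b))) ∧
    -- the two limits that define the wall free energy exist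
    (∀ b : Bool,
      Tendsto
        (SemiInfiniteIsing.surfaceFreeEnergySeq d J 0 (SemiInfiniteIsing.decayingField d δ lam) b)
        atTop
        (𝓝 (SemiInfiniteIsing.surfaceFreeEnergy d J 0
          (SemiInfiniteIsing.decayingField d δ lam) b))) ∧
    -- the series converges and its sum is integrable
    (∀ s ∈ Set.Icc 0 lam, Summable (SemiInfiniteIsing.magnetizationGapTerm d J δ s)) ∧
    IntervalIntegrable (fun s => ∑' ℓ : ℕ+, SemiInfiniteIsing.magnetizationGapTerm d J δ s ℓ)
      volume 0 lam ∧
    -- the integral formula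
    SemiInfiniteIsing.wallFreeEnergy d J 0 (SemiInfiniteIsing.decayingField d δ lam) =
      ∫ s in (0 : ℝ)..lam, ∑' ℓ : ℕ+, SemiInfiniteIsing.magnetizationGapTerm d J δ s ℓ := by
  have hJ₀ := hJ.le
  obtain ⟨F₀, hF⟩ := SemiInfiniteIsing.exists_tendsto_surfaceFreeEnergySeq (d := d) hJ₀ hδ lam
  have hint := SemiInfiniteIsing.intervalIntegrable_plusSeries (d := d) hJ₀ hδ
  -- Integrability on `[-lam, 0]`, reflected.
  have hint' : IntervalIntegrable (fun s => SemiInfiniteIsing.plusSeries d J δ (-s)) volume 0 lam :=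
    by simpa using (hint 0 (-lam)).comp_sub_left 0
  simp only [SemiInfiniteIsing.tsum_magnetizationGapTerm hJ₀ hδ]
  refine ⟨fun s _ b => SemiInfiniteIsing.tendsto_gibbs_infiniteState _ hJ₀ _ b,
    fun b => tendsto_nhds_limUnder ⟨_, hF b⟩,
    fun s _ => SemiInfiniteIsing.summable_magnetizationGapTerm hJ₀ hδ s,
    (hint 0 lam).add hint', ?_⟩
  -- The constant `F₀` cancels, and reversing `s` turns `-∫₀^{-lam} P(s) ds` into `∫₀^lam P(-s) ds`.
  rw [SemiInfiniteIsing.wallFreeEnergy, SemiInfiniteIsing.surfaceFreeEnergy,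
    SemiInfiniteIsing.surfaceFreeEnergy, (hF false).limUnder_eq, (hF true).limUnder_eq,
    intervalIntegral.integral_add (hint 0 lam) hint',
    intervalIntegral.integral_comp_neg (SemiInfiniteIsing.plusSeries d J δ), neg_zero,
    intervalIntegral.integral_symm 0 (-lam)]
  simp
  ring
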